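/- Let $X$ be a real Banach space, $B_{X^*}$ the closed unit ball of $X^*$, $cb(X)$ the family of nonempty closed convex bounded subsets of $X$ with the Hausdorff metric $d_H$, and $s(x^*,C)=\sup_{x\in C}\langle x^*,x\rangle$. Let $\mathcal I$ be the family of closed (nondegenerate) subintervals of $[0,1]$, $\lambda$ Lebesgue measure and $\mathcal L$ the Lebesgue measurable subsets of $[0,1]$. For $g:\mathcal I\to\mathbb R$ let $\widetilde g([0,1])=\sup\sum_i|g(I_i)|$, the supremum being over all finite partitions of $[0,1]$ into nonoverlapping intervals $I_i\in\mathcal I$; for $\Phi:\mathcal I\to cb(X)$ let $\widetilde\Phi([0,1])$ be the same supremum for $g(I)=d_H(\Phi(I),\{0\})$, and put $\langle x^*,\Phi\rangle(I)=s(x^*,\Phi(I))$. Let $\Phi:\mathcal I\to cb(X)$ be the Denjoy--Khintchine--Pettis integral of $\Gamma:[0,1]\to cb(X)$; that is, for every $x^*\in X^*$ there is a function $F$ that is ACG on $[0,1]$ (continuous on $[0,1]$, with $[0,1]$ a countable union of sets on each of which $F$ is absolutely continuous), whose approximate derivative equals $s(x^*,\Gamma(t))$ for almost every $t\in[0,1]$,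 and such that $s(x^*,\Phi([a,b]))=F(b)-F(a)$ for all $[a,b]\in\mathcal I$. 1. If $\sup_{x^*\in B_{X^*}}\widetilde{\langle x^*,\Phi\rangle}([0,1])<\infty$, then $\Gamma$ is weakly McShane integrable in $cb(X)$, i.e. $s(x^*,\Gamma)$ is Lebesgue integrable for every $x^*\in X^*$ and for each $I\in\mathcal I$ there is $N(I)\in cb(X)$ such that for every $x^*\in X^*$ the Henstock--Kurzweil integral of $s(x^*,\Gamma)$ over $I$ exists and equals $s(x^*,N(I))$; and $\Gamma$ is Gelfand integrable in $cw^*k(X^{**})$, i.e. $s(x^*,\Gamma)$ is Lebesgue integrable for every $x^*\in X^*$ and for each $A\in\mathcal L$ there is a nonempty convex weak*-compact set $M(A)\subset X^{**}$ with $\sup_{z\in M(A)}\langle z,x^*\rangle=\int_A s(x^*,\Gamma)\,d\lambda$ for every $x^*\in X^*$. 2. If $\widetilde\Phi([0,1])<\infty$, then $\Gamma$ is strongly Pettis integrable in $cb(X)$, i.e. $s(x^*,\Gamma)$ is Lebesgue integrable for every $x^*\in X^*$, for each $A\in\mathcal L$ there is $M(A)\in cb(X)$ with $s(x^*,M(A))=\int_A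 s(x^*,\Gamma)\,d\lambda$ for every $x^*\in X^*$, and $M$ is countably additive in $d_H$: for pairwise disjoint $A_1,A_2,\dots\in\mathcal L$, $d_H\big(\overline{M(A_1)+\dots+M(A_n)},\,M(\bigcup_i A_i)\big)\to0$. -/

import Mathlib

open scoped Pointwise

noncomputable section

namespace MultiIntegral

/-- The closed nondegenerate subintervals of `[0,1]`. -/
structure Subinterval where
  left : ℝ
  right : ℝ
  zero_le_left : 0 ≤ left
  left_lt_right : left < right
  right_le_one : right ≤ 1

/-- A finite partition of `[0,1]` into nonoverlapping intervals, given by its division points. -/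
structure IntervalPartition where
  n : ℕ
  pt : Fin (n + 1) → ℝ
  strictMono : StrictMono pt
  first : pt 0 = 0
  last : pt (Fin.last n) = 1

/-- The `i`-th interval of a partition. -/
def IntervalPartition.cell (P : IntervalPartition) (i : Fin P.n) : Subinterval where
  left := P.pt i.castSucc
  right := P.pt i.succ
  zero_le_left := P.first ▸ P.strictMono.monotone (Fin.zero_le _)
  left_lt_right := P.strictMono i.castSucc_lt_succ
  right_le_one := P.last ▸ P.strictMono.monotone (Fin.le_last _)

/-- The interval variation on `[0,1]` of a real function of intervals. -/
def intervalVariation (g : Subinterval → ℝ) : ENNReal :=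
  ⨆ P : IntervalPartition, ∑ i : Fin P.n, ENNReal.ofReal |g (P.cell i)|

section RealIntegrals

/-- `F` is AC on the set `E`. -/
def IsACOn (F : ℝ → ℝ) (E : Set ℝ) : Prop :=
  ∀ ε : ℝ, 0 < ε → ∃ η : ℝ, 0 < η ∧ ∀ (n : ℕ) (c d : Fin n → ℝ),
    (∀ i, c i ∈ E ∧ d i ∈ E ∧ c i ≤ d i) →
    (Pairwise fun i j => Disjoint (Set.Ioo (c i) (d i)) (Set.Ioo (c j) (d j))) →
    ∑ i, (d i - c i) < η → ∑ i, |F (d i) - F (c i)| < ε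

/-- `F` is ACG on the set `E`. -/
def IsACGOn (F : ℝ → ℝ) (E : Set ℝ) : Prop :=
  ContinuousOn F E ∧ ∃ S : ℕ → Set ℝ, E = ⋃ n, S n ∧ ∀ n, IsACOn F (S n)

/-- `t` is a point of density of `E`. -/
def IsDensityPoint (E : Set ℝ) (t : ℝ) : Prop :=
  Filter.Tendsto
    (fun h : ℝ => MeasureTheory.volume (E ∩ Set.Icc (t - h) (t + h)) / ENNReal.ofReal (2 * h))
    (nhdsWithin 0 (Set.Ioi 0)) (nhds 1)

/-- `F` has approximate derivative `y` at `t`. -/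
def HasApproxDerivAt (F : ℝ → ℝ) (y t : ℝ) : Prop :=
  ∃ E : Set ℝ, MeasurableSet E ∧ t ∈ E ∧ IsDensityPoint E t ∧ HasDerivWithinAt F y E t

/-- `F` is a Denjoy–Khintchine primitive of `f` on `[0,1]`; the Denjoy–Khintchine integral of `f`
over `[a,b] ⊆ [0,1]` is then `F b - F a`. -/
def IsDKPrimitive (F f : ℝ → ℝ) : Prop :=
  IsACGOn F (Set.Icc 0 1) ∧
    ∀ᵐ t ∂(MeasureTheory.volume.restrict (Set.Icc (0 : ℝ) 1)), HasApproxDerivAt F (f t) t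

/-- A subinterval as a one-dimensional box. -/
def Subinterval.toBox (I : Subinterval) : BoxIntegral.Box (Fin 1) where
  lower := fun _ => I.left
  upper := fun _ => I.right
  lower_lt_upper := fun _ => I.left_lt_right

/-- The Henstock–Kurzweil integral of `f` over `I` exists and equals `y`. -/
def HasHKIntegral (f : ℝ → ℝ) (I : Subinterval) (y : ℝ) : Prop :=
  BoxIntegral.HasIntegral I.toBox BoxIntegral.IntegrationParams.Henstock
    (fun x : Fin 1 → ℝ => f (x 0)) BoxIntegral.BoxAdditiveMap.volume y

/-- The Lebesgue measurable subsets of `[0,1]`. -/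
def lebesgueSets : Set (Set ℝ) :=
  {A | A ⊆ Set.Icc 0 1 ∧ MeasureTheory.NullMeasurableSet A MeasureTheory.volume}

end RealIntegrals

section Multifunctions

variable {X : Type*} [NormedAddCommGroup X] [NormedSpace ℝ X]

/-- The nonempty closed convex bounded subsets of `X`. -/
def cb (X : Type*) [NormedAddCommGroup X] [NormedSpace ℝ X] : Set (Set X) :=
  {C | C.Nonempty ∧ IsClosed C ∧ Convex ℝ C ∧ Bornology.IsBounded C}

/-- The nonempty convex weak*-compact subsets of the bidual of `X`. -/
def cwstark (X : Type*) [NormedAddCommGroup X] [NormedSpace ℝ X] :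
    Set (Set (WeakDual ℝ (StrongDual ℝ X))) :=
  {K | K.Nonempty ∧ Convex ℝ K ∧ IsCompact K}

/-- The support function `s(x*, C)` of a subset of `X`. -/
def supp (x : StrongDual ℝ X) (C : Set X) : ℝ :=
  sSup ((fun v : X => x v) '' C)

/-- The support function `s(x*, K)`, `x* ∈ X*`, of a subset of the bidual. -/
def suppBidual (x : StrongDual ℝ X) (K : Set (WeakDual ℝ (StrongDual ℝ X))) : ℝ :=
  sSup ((fun z : WeakDual ℝ (StrongDual ℝ X) => z x) '' K)

/-- `Φ` is the Denjoy–Khintchine–Pettis integral in `cb(X)` of `Γ`. -/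
def IsDKPIntegral (Γ : ℝ → Set X) (Φ : Subinterval → Set X) : Prop :=
  (∀ I, Φ I ∈ cb X) ∧
    ∀ x : StrongDual ℝ X, ∃ F : ℝ → ℝ, IsDKPrimitive F (fun t => supp x (Γ t)) ∧
      ∀ I : Subinterval, supp x (Φ I) = F I.right - F I.left

/-- Every `s(x*, Γ)` is Lebesgue integrable on `[0,1]`. -/
def ScalarlyIntegrable (Γ : ℝ → Set X) : Prop :=
  ∀ x : StrongDual ℝ X,
    MeasureTheory.IntegrableOn (fun t => supp x (Γ t)) (Set.Icc 0 1) MeasureTheory.volume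

/-- Henstock–Kurzweil–Pettis integrability in `cb(X)`. -/
def HKPIntegrable (Γ : ℝ → Set X) : Prop :=
  ∃ N : Subinterval → Set X, (∀ I, N I ∈ cb X) ∧
    ∀ (x : StrongDual ℝ X) (I : Subinterval),
      HasHKIntegral (fun t => supp x (Γ t)) I (supp x (N I))

/-- Weak McShane integrability in `cb(X)`. -/
def WeaklyMcShaneIntegrable (Γ : ℝ → Set X) : Prop :=
  HKPIntegrable Γ ∧ ScalarlyIntegrable Γ

/-- Gelfand integrability in `cw*k(X**)`. -/
def GelfandIntegrable (Γ : ℝ → Set X) : Prop :=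
  ScalarlyIntegrable Γ ∧
    ∃ M : Set ℝ → Set (WeakDual ℝ (StrongDual ℝ X)), ∀ A ∈ lebesgueSets, M A ∈ cwstark X ∧
      ∀ x : StrongDual ℝ X, suppBidual x (M A) = ∫ t in A, supp x (Γ t)

/-- `M` is the Pettis integral in `cb(X)` of `Γ`. -/
def IsPettisIntegral (Γ : ℝ → Set X) (M : Set ℝ → Set X) : Prop :=
  ScalarlyIntegrable Γ ∧
    ∀ A ∈ lebesgueSets, M A ∈ cb X ∧
      ∀ x : StrongDual ℝ X, supp x (M A) = ∫ t in A, supp x (Γ t)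

/-- `M` is countably additive on the Lebesgue subsets of `[0,1]` in the Hausdorff metric; sums in
`cb(X)` are closures of Minkowski sums. -/
def IsHMultimeasure (M : Set ℝ → Set X) : Prop :=
  ∀ A : ℕ → Set ℝ, (∀ n, A n ∈ lebesgueSets) → Pairwise (Function.onFun Disjoint A) →
    Filter.Tendsto
      (fun n : ℕ => Metric.hausdorffDist (closure (∑ i ∈ Finset.range n, M (A i))) (M (⋃ i, A i)))
      Filter.atTop (nhds 0)

/-- Strong Pettis integrability in `cb(X)`. -/
def StronglyPettisIntegrable (Γ : ℝ → Set X) : Prop :=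
  ∃ M : Set ℝ → Set X, IsPettisIntegral Γ M ∧ IsHMultimeasure M

end Multifunctions

end MultiIntegral

end

/-! Fix a functional `x`. Finite variation of the interval function `supp x (Φ I)` makes its
Denjoy–Khintchine primitive `F` a function of bounded variation. An ACG function is continuous and
maps null sets to null sets, so by the Banach–Zarecki theorem `F` is absolutely continuous. Its
derivative exists almost everywhere and equals the approximate derivative there, so `supp x (Γ t)`
is Lebesgue integrable with primitive `F` (`IsDKPrimitive.integrableOn_and_integral_eq`).

Each indefinite integral is dominated by a finite measure of mass at most the variation
(`exists_measure_abs_setIntegral_le`). In the first claim this measure depends on `x`, and only its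
mass is uniformly bounded over the unit ball. Hence for each `A` the map sending `x` to the integral
over `A` is a bounded sublinear functional, which Hahn–Banach and Banach–Alaoglu represent by a
weak*-compact set in the bidual (`exists_mem_cwstark_of_sublinear`).

In the second claim one measure `μ` serves the whole unit ball. By the Hörmander-type bound
`hausdorffDist_le_of_abs_supp_sub_le`, convergence of sets in `μ` then becomes convergence in the
Hausdorff metric. Starting from the values of `Φ`, completeness carries the integral from finite
unions of intervals to open sets and on to measurable sets without leaving `X`; countable additivity
follows from that of `μ`. -/

noncomputable section

namespace MultiIntegral

open MeasureTheory Set Filter Topology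

/-! ### Lusin's condition (N), the Banach–Zarecki theorem and Denjoy–Khintchine primitives. -/

section RealAnalysis

/-- Choices at different indices are independent, so a bound for every choice bounds the sum of
suprema. The term `b` holds the choices already made and keeps the induction going. -/
theorem add_sum_iSup_le {ι : Type*} {κ : Type*} [DecidableEq ι] (T : Finset ι)
    (g : ι → κ → ENNReal) (s : ι → Set κ) (hs : ∀ i, (s i).Nonempty) (B : ENNReal) :
    ∀ b : ENNReal, (∀ k : ι → κ, (∀ i, k i ∈ s i) → b + ∑ i ∈ T, g i (k i) ≤ B) →
      b + ∑ i ∈ T, ⨆ j ∈ s i, g i j ≤ B := by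
  induction T using Finset.induction_on with
  | empty =>
    intro b h
    choose k hk using hs
    simpa using h k hk
  | insert a T ha ih =>
    intro b h
    rw [Finset.sum_insert ha, ← add_assoc]
    have : b + ⨆ j ∈ s a, g a j = ⨆ j ∈ s a, (b + g a j) := ENNReal.add_biSup (hs a) _
    rw [this, ENNReal.biSup_add (hs a)]
    refine iSup₂_le fun j hj => ih _ fun k hk => ?_
    have := h (Function.update k a j) (fun i => by
      by_cases hi : i = a
      · subst hi; simpa using hj
      · simpa [hi] using hk i)
    rw [Finset.sum_insert ha, ← add_assoc, Function.update_self] at this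
    refine le_trans (le_of_eq ?_) this
    congr 1
    refine Finset.sum_congr rfl fun i hi => ?_
    rw [Function.update_of_ne (by rintro rfl; exact ha hi)]

theorem IsACOn.exists_finset {F : ℝ → ℝ} {E : Set ℝ} (hF : IsACOn F E) {ε : ℝ} (hε : 0 < ε) :
    ∃ η : ℝ, 0 < η ∧ ∀ {ι : Type} (T : Finset ι) (c d : ι → ℝ),
      (∀ i ∈ T, c i ∈ E ∧ d i ∈ E ∧ c i ≤ d i) →
      ((T : Set ι).PairwiseDisjoint fun i => Ioo (c i) (d i)) →
      ∑ i ∈ T, (d i - c i) < η → ∑ i ∈ T, |F (d i) - F (c i)| < ε := by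
  obtain ⟨η, hη, h⟩ := hF ε hε
  refine ⟨η, hη, fun {ι} T c d h1 h2 h3 => ?_⟩
  let e := T.equivFin
  have key : ∀ g : ι → ℝ, ∑ i, g (e.symm i) = ∑ i ∈ T, g i := fun g => by
    rw [← Finset.sum_coe_sort T g]
    exact e.symm.sum_comp (fun i : T => g i)
  have := h T.card (fun i => c (e.symm i)) (fun i => d (e.symm i))
    (fun i => h1 _ (e.symm i).2) (fun i j hij => h2 (e.symm i).2 (e.symm j).2 (by
      intro hh; exact hij (e.symm.injective (Subtype.ext hh))))
  rw [key (fun i => d i - c i), key (fun i => |F (d i) - F (c i)|)] at this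
  exact this h3

/-- A function that is absolutely continuous on a set maps its null subsets to null sets. -/
theorem IsACOn.volume_image_eq_zero {F : ℝ → ℝ} {S Z : Set ℝ} (hF : IsACOn F S) (hZS : Z ⊆ S)
    (hZ : volume Z = 0) : volume (F '' Z) = 0 := by
  classical
  refine le_antisymm (ENNReal.le_of_forall_pos_le_add fun ε hε _ => ?_) bot_le
  rw [zero_add]
  obtain ⟨η, hη, h⟩ := hF.exists_finset (ε := ε) (by exact_mod_cast hε)
  obtain ⟨U, hZU, hUo, hU⟩ := Z.exists_isOpen_lt_of_lt (μ := volume) (ENNReal.ofReal η)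
    (by rw [hZ]; simpa using hη)
  set 𝒞 : Set (Set ℝ) := (fun x => connectedComponentIn U x) '' Z with h𝒞
  have hopen : ∀ J ∈ 𝒞, IsOpen J := by
    rintro _ ⟨x, _, rfl⟩; exact hUo.connectedComponentIn
  have hne : ∀ J ∈ 𝒞, (Z ∩ J).Nonempty := by
    rintro _ ⟨x, hx, rfl⟩; exact ⟨x, hx, mem_connectedComponentIn (hZU hx)⟩
  have hconn : ∀ J ∈ 𝒞, J.OrdConnected := by
    rintro _ ⟨x, _, rfl⟩; exact isPreconnected_connectedComponentIn.ordConnected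
  have hsub : ∀ J ∈ 𝒞, J ⊆ U := by
    rintro _ ⟨x, _, rfl⟩; exact connectedComponentIn_subset U x
  have hdisj : 𝒞.PairwiseDisjoint id := by
    rintro _ ⟨x, _, rfl⟩ _ ⟨y, _, rfl⟩ hxy
    rw [Function.onFun, Set.disjoint_left]
    intro z hzx hzy
    exact hxy ((connectedComponentIn_eq hzx).trans (connectedComponentIn_eq hzy).symm)
  have hcount : 𝒞.Countable :=
    hdisj.countable_of_isOpen hopen fun J hJ => (hne J hJ).mono inter_subset_right
  have hcover : F '' Z ⊆ ⋃ J ∈ 𝒞, F '' (Z ∩ J) := by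
    rintro _ ⟨x, hx, rfl⟩
    refine mem_biUnion (mem_image_of_mem _ hx) ⟨x, ⟨hx, mem_connectedComponentIn (hZU hx)⟩, rfl⟩
  calc volume (F '' Z) ≤ volume (⋃ J ∈ 𝒞, F '' (Z ∩ J)) := measure_mono hcover
    _ ≤ ∑' J : 𝒞, volume (F '' (Z ∩ J)) := measure_biUnion_le _ hcount _
    -- Bounding measure by diameter turns the estimate into oscillations over pairs of points, one
    -- pair in each component. These pairs span disjoint intervals of total length below `η`, to
    -- which absolute continuity applies.
    _ ≤ ∑' J : 𝒞, ⨆ p ∈ (Z ∩ (J : Set ℝ)) ×ˢ (Z ∩ (J : Set ℝ)), edist (F p.1) (F p.2) := by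
        refine ENNReal.tsum_le_tsum fun J => (Real.volume_le_diam _).trans ?_
        refine Metric.ediam_le ?_
        rintro _ ⟨x, hx, rfl⟩ _ ⟨y, hy, rfl⟩
        exact le_iSup₂ (f := fun (p : ℝ × ℝ) (_ : p ∈ (Z ∩ (J : Set ℝ)) ×ˢ (Z ∩ (J : Set ℝ))) =>
          edist (F p.1) (F p.2)) (x, y) ⟨hx, hy⟩
    _ ≤ ε := by
        rw [ENNReal.tsum_eq_iSup_sum]
        refine iSup_le fun T => ?_
        have := add_sum_iSup_le T (fun (_ : 𝒞) (p : ℝ × ℝ) => edist (F p.1) (F p.2))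
          (fun J => (Z ∩ (J : Set ℝ)) ×ˢ (Z ∩ (J : Set ℝ)))
          (fun J => (hne J J.2).prod (hne J J.2)) ε 0
        rw [zero_add] at this
        refine this fun k hk => ?_
        rw [zero_add]
        have hmin : ∀ J : 𝒞, min (k J).1 (k J).2 ∈ Z ∩ (J : Set ℝ) := fun J => by
          rcases min_choice (k J).1 (k J).2 with h | h <;> rw [h]
          exacts [(hk J).1, (hk J).2]
        have hmax : ∀ J : 𝒞, max (k J).1 (k J).2 ∈ Z ∩ (J : Set ℝ) := fun J => by
          rcases max_choice (k J).1 (k J).2 with h | h <;> rw [h]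
          exacts [(hk J).1, (hk J).2]
        have hIoo : ∀ J : 𝒞, Ioo (min (k J).1 (k J).2) (max (k J).1 (k J).2) ⊆ (J : Set ℝ) :=
          fun J => Ioo_subset_Icc_self.trans ((hconn J J.2).out (hmin J).2 (hmax J).2)
        have hdT : ((T : Set 𝒞).PairwiseDisjoint fun J : 𝒞 => (J : Set ℝ)) := by
          intro J _ K _ hJK
          exact hdisj J.2 K.2 (fun h => hJK (Subtype.ext h))
        have hsum := h T (fun J => min (k J).1 (k J).2) (fun J => max (k J).1 (k J).2)
          (fun J _ => ⟨hZS (hmin J).1, hZS (hmax J).1, min_le_max⟩)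
          (fun J hJ K hK hJK => (hdT hJ hK hJK).mono (hIoo J) (hIoo K)) (by
            have h1 : ∑ J ∈ T, ENNReal.ofReal (max (k J).1 (k J).2 - min (k J).1 (k J).2)
                < ENNReal.ofReal η := by
              refine lt_of_le_of_lt ?_ hU
              calc ∑ J ∈ T, ENNReal.ofReal (max (k J).1 (k J).2 - min (k J).1 (k J).2)
                  ≤ ∑ J ∈ T, volume (J : Set ℝ) := by
                    refine Finset.sum_le_sum fun J _ => ?_
                    rw [← Real.volume_Ioo]
                    exact measure_mono (hIoo J)
                _ = volume (⋃ J ∈ T, (J : Set ℝ)) :=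
                    (measure_biUnion_finset hdT fun J _ => (hopen J J.2).measurableSet).symm
                _ ≤ volume U := measure_mono (iUnion₂_subset fun J _ => hsub J J.2)
            rw [← ENNReal.ofReal_sum_of_nonneg (fun J _ => sub_nonneg.2 min_le_max)] at h1
            exact (ENNReal.ofReal_lt_ofReal_iff hη).1 h1)
        have heq : ∀ J : 𝒞, edist (F (k J).1) (F (k J).2) =
            ENNReal.ofReal |F (max (k J).1 (k J).2) - F (min (k J).1 (k J).2)| := fun J => by
          rcases le_total (k J).1 (k J).2 with h | h
          · rw [min_eq_left h, max_eq_right h, edist_comm, edist_dist, Real.dist_eq]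
          · rw [min_eq_right h, max_eq_left h, edist_dist, Real.dist_eq]
        simp_rw [heq]
        rw [← ENNReal.ofReal_sum_of_nonneg (fun J _ => abs_nonneg _)]
        refine ENNReal.ofReal_le_of_le_toReal ?_
        simpa using hsum.le

theorem IsACGOn.volume_image_eq_zero {F : ℝ → ℝ} {E Z : Set ℝ} (hF : IsACGOn F E) (hZE : Z ⊆ E)
    (hZ : volume Z = 0) : volume (F '' Z) = 0 := by
  obtain ⟨-, S, hS, hAC⟩ := hF
  have : Z = ⋃ n, Z ∩ S n := by
    rw [← inter_iUnion, ← hS, inter_eq_left.2 hZE]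
  rw [this, image_iUnion, measure_iUnion_null_iff]
  exact fun n => (hAC n).volume_image_eq_zero inter_subset_right
    (measure_mono_null inter_subset_left hZ)

/-- By the intermediate value theorem the image of `[a,b]` covers the interval between `F a` and `F
b`. Non-differentiability points have null image by (N), and the image of the rest has measure at
most the integral of `|F'|`. -/
theorem ofReal_abs_sub_le_lintegral_enorm_deriv {F : ℝ → ℝ} {a b : ℝ} (hab : a ≤ b)
    (hc : ContinuousOn F (Icc a b))
    (hN : ∀ Z ⊆ Icc a b, volume Z = 0 → volume (F '' Z) = 0)
    (hd : ∀ᵐ t, t ∈ Icc a b → DifferentiableAt ℝ F t) :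
    ENNReal.ofReal |F b - F a| ≤ ∫⁻ t in Icc a b, ‖deriv F t‖ₑ := by
  set D : Set ℝ := {t | DifferentiableAt ℝ F t}
  have hD : MeasurableSet D := measurableSet_of_differentiableAt ℝ F
  have h1 : uIcc (F a) (F b) ⊆ F '' (Icc a b ∩ D) ∪ F '' (Icc a b \ D) := by
    rw [← image_union, inter_union_sdiff]
    have := intermediate_value_uIcc (a := a) (b := b) (f := F) (by rwa [uIcc_of_le hab])
    rwa [uIcc_of_le hab] at this
  have h2 : volume (F '' (Icc a b \ D)) = 0 := by
    refine hN _ sdiff_subset ?_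
    rw [ae_iff] at hd
    refine measure_mono_null (fun t ht => ?_) hd
    exact fun h => ht.2 (h ht.1)
  have h3 := addHaar_image_le_lintegral_abs_det_fderiv volume (f := F) (s := Icc a b ∩ D)
    (f' := fun t => fderiv ℝ F t) (measurableSet_Icc.inter hD)
    (fun t ht => (ht.2 : DifferentiableAt ℝ F t).hasFDerivAt.hasFDerivWithinAt)
  calc ENNReal.ofReal |F b - F a| = volume (uIcc (F a) (F b)) := by rw [Real.volume_interval]
    _ ≤ volume (F '' (Icc a b ∩ D)) + volume (F '' (Icc a b \ D)) :=
        (measure_mono h1).trans (measure_union_le _ _)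
    _ ≤ ∫⁻ t in Icc a b ∩ D, ENNReal.ofReal |(fderiv ℝ F t).det| := by rw [h2, add_zero]; exact h3
    _ ≤ ∫⁻ t in Icc a b, ENNReal.ofReal |(fderiv ℝ F t).det| :=
        lintegral_mono_set inter_subset_left
    _ = ∫⁻ t in Icc a b, ‖deriv F t‖ₑ := by
        refine lintegral_congr fun t => ?_
        rw [← toSpanSingleton_deriv, ContinuousLinearMap.det_toSpanSingleton, Real.enorm_eq_ofReal_abs]

/-- A continuous function of bounded variation that maps null sets to null sets is absolutely
continuous. -/
theorem absolutelyContinuousOnInterval_of_boundedVariationOn {F : ℝ → ℝ}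
    {a b : ℝ} (hab : a ≤ b) (hc : ContinuousOn F (Icc a b))
    (hN : ∀ Z ⊆ Icc a b, volume Z = 0 → volume (F '' Z) = 0)
    (hV : BoundedVariationOn F (uIcc a b)) :
    AbsolutelyContinuousOnInterval F a b := by
  have hderiv := hV.intervalIntegrable_deriv
  have hd := hV.ae_differentiableAt_of_mem_uIcc
  -- Increments of `F` are dominated by those of the indefinite integral of `|F'|`, which is
  -- absolutely continuous because bounded variation makes `F'` integrable.
  have hle : ∀ c d, c ∈ Icc a b → d ∈ Icc a b →
      dist (F c) (F d) ≤ dist (∫ t in a..c, ‖deriv F t‖) (∫ t in a..d, ‖deriv F t‖) := by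
    intro c d
    wlog hcd : c ≤ d generalizing c d
    · intro h1 h2
      rw [dist_comm (F c), dist_comm (∫ t in a..c, _)]
      exact this d c (le_of_not_ge hcd) h2 h1
    intro h1 h2
    have hsub : Icc c d ⊆ Icc a b := Icc_subset_Icc h1.1 h2.2
    have hderiv' : ∀ e ∈ Icc a b, IntervalIntegrable (fun t => ‖deriv F t‖) volume a e := by
      intro e he
      refine hderiv.norm.mono_set ?_
      rw [uIcc_of_le he.1, uIcc_of_le hab]
      exact Icc_subset_Icc le_rfl he.2
    have hcdI : IntegrableOn (deriv F) (Icc c d) :=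
      ((intervalIntegrable_iff_integrableOn_Icc_of_le hab).1 hderiv).mono_set hsub
    have key := ofReal_abs_sub_le_lintegral_enorm_deriv hcd (hc.mono hsub)
      (fun Z hZ => hN Z (hZ.trans hsub)) (hd.mono fun t ht htI => ht (by
        rw [uIcc_of_le hab]; exact hsub htI))
    rw [dist_comm (∫ t in a..c, _), Real.dist_eq, Real.dist_eq,
      intervalIntegral.integral_interval_sub_left (hderiv' d h2) (hderiv' c h1), abs_sub_comm]
    refine le_trans ?_ (le_abs_self _)
    rw [intervalIntegral.integral_of_le hcd, ← integral_Icc_eq_integral_Ioc]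
    rw [← ofReal_integral_norm_eq_lintegral_enorm hcdI] at key
    exact (ENNReal.ofReal_le_ofReal_iff (integral_nonneg fun _ => norm_nonneg _)).1 key
  have hAC := hderiv.norm.absolutelyContinuousOnInterval_intervalIntegral (c := a) (by simp)
  rw [absolutelyContinuousOnInterval_iff] at hAC ⊢
  intro ε hε
  obtain ⟨δ, hδ, h⟩ := hAC ε hε
  refine ⟨δ, hδ, fun E hE hs => lt_of_le_of_lt (Finset.sum_le_sum fun i hi => ?_) (h E hE hs)⟩
  have := hE.1 i hi
  rw [uIcc_of_le hab] at this
  exact hle _ _ this.1 this.2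

/-- A density point is an accumulation point, since positive measure in every small interval cannot
come from `t` alone. So the derivative within `E` is unique. -/
theorem HasApproxDerivAt.eq_deriv {F : ℝ → ℝ} {y t : ℝ} (h : HasApproxDerivAt F y t)
    (hd : DifferentiableAt ℝ F t) : y = deriv F t := by
  obtain ⟨E, -, -, hden, hder⟩ := h
  have hacc : UniqueDiffWithinAt ℝ E t := by
    rw [uniqueDiffWithinAt_iff_accPt, accPt_iff_nhds]
    intro U hU
    obtain ⟨r, hr, hrU⟩ := Metric.mem_nhds_iff.1 hU
    have h1 := hden.eventually (lt_mem_nhds (zero_lt_one))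
    have h2 : ∀ᶠ h : ℝ in 𝓝[>] 0, h < r := nhdsWithin_le_nhds (gt_mem_nhds hr)
    obtain ⟨s, ⟨hs, hsr⟩, hs0⟩ := ((h1.and h2).and self_mem_nhdsWithin).exists
    have hs0' : (0 : ℝ) < s := hs0
    have hpos : volume (E ∩ Icc (t - s) (t + s)) ≠ 0 := by
      intro h0; rw [h0] at hs; simp at hs
    by_contra hcon
    push Not at hcon
    refine hpos (measure_mono_null (t := {t}) (fun z hz => ?_) (by simp))
    refine hcon z ⟨hrU ?_, hz.1⟩
    rw [Metric.mem_ball, Real.dist_eq, abs_lt]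
    constructor <;> linarith [hz.2.1, hz.2.2]
  exact hacc.eq_deriv _ hder hd.hasDerivAt.hasDerivWithinAt

/-- A Denjoy–Khintchine primitive of bounded variation is a Lebesgue primitive. -/
theorem IsDKPrimitive.integrableOn_and_integral_eq {F f v : ℝ → ℝ} (hF : IsDKPrimitive F f)
    (hv : ∀ a b, 0 ≤ a → a < b → b ≤ 1 → |F b - F a| ≤ v b - v a) :
    IntegrableOn f (Icc 0 1) ∧
      ∀ a b, 0 ≤ a → a ≤ b → b ≤ 1 → ∫ t in Ioc a b, f t = F b - F a := by
  have hv' : ∀ a ∈ Icc (0 : ℝ) 1, ∀ b ∈ Icc (0 : ℝ) 1, a ≤ b → |F b - F a| ≤ v b - v a := by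
    intro a ha b hb hab
    rcases hab.eq_or_lt with rfl | hab
    · simp
    · exact hv a b ha.1 hab hb.2
  have hmono1 : MonotoneOn v (Icc 0 1) := fun a ha b hb hab => by
    linarith [hv' a ha b hb hab, abs_nonneg (F b - F a)]
  have hV : BoundedVariationOn F (uIcc 0 1) := by
    rw [uIcc_of_le zero_le_one]
    refine ne_top_of_le_ne_top ?_ (iSup_mono fun p => Finset.sum_le_sum fun i _ => ?_ :
      eVariationOn F (Icc 0 1) ≤ eVariationOn v (Icc 0 1))
    · have := hmono1.locallyBoundedVariationOn 0 1 (by simp) (by simp)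
      rwa [inter_self] at this
    · rw [edist_dist, edist_dist, Real.dist_eq, Real.dist_eq]
      exact ENNReal.ofReal_le_ofReal ((hv' _ (p.2.2.2 i) _ (p.2.2.2 (i + 1))
        (p.2.2.1 i.le_succ)).trans (le_abs_self _))
  have hAC := absolutelyContinuousOnInterval_of_boundedVariationOn zero_le_one hF.1.1
    (fun Z hZ h0 => hF.1.volume_image_eq_zero hZ h0) hV
  have hae : deriv F =ᵐ[volume.restrict (Icc 0 1)] f := by
    have hd := hAC.ae_differentiableAt
    rw [uIcc_of_le zero_le_one] at hd
    filter_upwards [hF.2, (ae_restrict_iff' measurableSet_Icc).2 hd] with t h1 h2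
    exact (h1.eq_deriv h2).symm
  refine ⟨((intervalIntegrable_iff_integrableOn_Icc_of_le zero_le_one).1
    hAC.intervalIntegrable_deriv).congr_fun_ae hae, fun a b ha hab hb => ?_⟩
  have hsub : Icc a b ⊆ Icc 0 1 := Icc_subset_Icc ha hb
  have := (hAC.mono (c := a) (d := b) (by
    rwa [uIcc_of_le hab, uIcc_of_le zero_le_one])).integral_deriv_eq_sub
  rw [← this, intervalIntegral.integral_of_le hab]
  have hae' : deriv F =ᵐ[volume.restrict (Ioc a b)] f :=
    ae_restrict_of_ae_restrict_of_subset (Ioc_subset_Icc_self.trans hsub) hae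
  exact integral_congr_ae hae'.symm

end RealAnalysis


/-! ### Dominating interval functions of finite variation by measures. -/

section Variation

theorem Subinterval.ext_endpoints {I J : Subinterval} (hl : I.left = J.left)
    (hr : I.right = J.right) : I = J := by
  cases I; cases J; simp_all

/-- `VariationChain g t c` says that `c` is the sum of the values of `|g|` on the intervals of some
partition of `[0,t]`. -/
inductive VariationChain (g : Subinterval → ℝ) : ℝ → ℝ → Prop
  | zero : VariationChain g 0 0
  | step (I : Subinterval) (c : ℝ) :
      VariationChain g I.left c → VariationChain g I.right (c + |g I|)

theorem VariationChain.exists_partition {g : Subinterval → ℝ} {t c : ℝ}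
    (h : VariationChain g t c) :
    ∃ (n : ℕ) (pt : Fin (n + 1) → ℝ) (cell : Fin n → Subinterval), StrictMono pt ∧ pt 0 = 0 ∧
      pt (Fin.last n) = t ∧
      (∀ i, (cell i).left = pt i.castSucc ∧ (cell i).right = pt i.succ) ∧
      ∑ i, |g (cell i)| = c := by
  induction h with
  | zero => exact ⟨0, fun _ => 0, Fin.elim0, fun i j h => absurd h (by omega), rfl, rfl,
      fun i => i.elim0, by simp⟩
  | step I c _ ih =>
    obtain ⟨n, pt, cell, hm, h0, hl, hc, hs⟩ := ih
    refine ⟨n + 1, Fin.snoc (α := fun _ => ℝ) pt I.right,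
      Fin.snoc (α := fun _ => Subinterval) cell I, ?_, ?_, ?_, ?_, ?_⟩
    · rw [Fin.strictMono_iff_lt_succ]
      intro i
      refine Fin.lastCases ?_ (fun j => ?_) i
      · rw [Fin.succ_last, Fin.snoc_castSucc, Fin.snoc_last, hl]
        exact I.left_lt_right
      · rw [Fin.succ_castSucc, Fin.snoc_castSucc, Fin.snoc_castSucc]
        exact hm j.castSucc_lt_succ
    · rw [← Fin.castSucc_zero, Fin.snoc_castSucc, h0]
    · rw [Fin.snoc_last]
    · intro i
      refine Fin.lastCases ?_ (fun j => ?_) i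
      · rw [Fin.succ_last, Fin.snoc_castSucc, Fin.snoc_last, Fin.snoc_last, hl]
        exact ⟨rfl, rfl⟩
      · rw [Fin.succ_castSucc, Fin.snoc_castSucc, Fin.snoc_castSucc, Fin.snoc_castSucc]
        exact hc j
    · rw [Fin.sum_univ_castSucc]
      simp only [Fin.snoc_castSucc, Fin.snoc_last]
      rw [hs]

theorem VariationChain.mem_Icc {g : Subinterval → ℝ} {t c : ℝ} (h : VariationChain g t c) :
    t ∈ Icc (0 : ℝ) 1 := by
  cases h with
  | zero => simp
  | step I c _ => exact ⟨I.zero_le_left.trans I.left_lt_right.le, I.right_le_one⟩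

theorem VariationChain.le_intervalVariation {g : Subinterval → ℝ} {t c : ℝ}
    (h : VariationChain g t c) (hg : intervalVariation g < ⊤) :
    c ≤ (intervalVariation g).toReal := by
  have hone : ∀ c, VariationChain g 1 c → c ≤ (intervalVariation g).toReal := by
    intro c hc
    obtain ⟨n, pt, cell, hm, h0, hl, hcell, hs⟩ := hc.exists_partition
    let P : IntervalPartition := ⟨n, pt, hm, h0, hl⟩
    have hPc : ∀ i : Fin n, P.cell i = cell i := fun i =>
      Subinterval.ext_endpoints (hcell i).1.symm (hcell i).2.symm
    have : ∑ i : Fin n, ENNReal.ofReal |g (P.cell i)| ≤ intervalVariation g :=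
      le_iSup (fun P : IntervalPartition => ∑ i : Fin P.n, ENNReal.ofReal |g (P.cell i)|) P
    simp_rw [hPc] at this
    rw [← ENNReal.ofReal_sum_of_nonneg (fun _ _ => abs_nonneg _), hs] at this
    exact (ENNReal.ofReal_le_iff_le_toReal hg.ne).1 this
  rcases h.mem_Icc.2.eq_or_lt with rfl | ht
  · exact hone c h
  -- Appending `[t,1]` completes the chain to a partition of `[0,1]` and can only increase the sum.
  · have := hone _ (VariationChain.step ⟨t, 1, h.mem_Icc.1, ht, le_rfl⟩ c h)
    linarith [abs_nonneg (g ⟨t, 1, h.mem_Icc.1, ht, le_rfl⟩)]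

/-- An interval function of finite variation is dominated by the increments of a function. -/
theorem exists_abs_le_sub_of_intervalVariation_lt_top {g : Subinterval → ℝ}
    (hg : intervalVariation g < ⊤) :
    ∃ v : ℝ → ℝ, (∀ I : Subinterval, |g I| ≤ v I.right - v I.left) ∧
      v 1 - v 0 ≤ (intervalVariation g).toReal := by
  have hbdd : ∀ t, BddAbove {c | VariationChain g t c} := fun t =>
    ⟨_, fun c hc => VariationChain.le_intervalVariation hc hg⟩
  have hne : ∀ t, 0 ≤ t → t ≤ 1 → {c | VariationChain g t c}.Nonempty := by
    intro t h0 h1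
    rcases h0.eq_or_lt with rfl | h0
    · exact ⟨0, .zero⟩
    · exact ⟨_, VariationChain.step ⟨0, t, le_rfl, h0, h1⟩ 0 .zero⟩
  -- The dominating function is the variation over `[0,t]`; appending `I` to any chain ending at its
  -- left endpoint gives the increment bound.
  refine ⟨fun t => sSup {c | VariationChain g t c}, fun I => ?_, ?_⟩
  · have : sSup {c | VariationChain g I.left c} ≤ sSup {c | VariationChain g I.right c} - |g I| :=
      csSup_le (hne _ I.zero_le_left (I.left_lt_right.le.trans I.right_le_one)) fun c hc =>
        le_sub_iff_add_le.2 (le_csSup (hbdd _) (VariationChain.step I c hc))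
    simp only
    linarith
  · have h1 : sSup {c | VariationChain g 1 c} ≤ (intervalVariation g).toReal :=
      csSup_le (hne 1 zero_le_one le_rfl) fun c hc => VariationChain.le_intervalVariation hc hg
    have h0 : 0 ≤ sSup {c | VariationChain g 0 c} := le_csSup (hbdd 0) .zero
    simp only
    linarith

/-- The difference `r` of `s` and the primitive of `h` is nondecreasing, hence a Stieltjes function.
Its measure is the nonnegative gap between the two sides. -/
theorem setIntegral_le_stieltjes_real {s : StieltjesFunction ℝ} {h : ℝ → ℝ} (hi : Integrable h)
    (hs : ∀ a b, a ≤ b → ∫ t in Ioc a b, h t ≤ s b - s a) {A : Set ℝ} (hA : MeasurableSet A)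
    (hfin : s.measure A ≠ ⊤) : ∫ t in A, h t ≤ s.measure.real A := by
  have hG : ∀ a b, a ≤ b → ∫ t in Ioc a b, h t = (∫ t in (0)..b, h t) - ∫ t in (0)..a, h t := by
    intro a b hab
    rw [intervalIntegral.integral_interval_sub_left hi.intervalIntegrable hi.intervalIntegrable,
      intervalIntegral.integral_of_le hab]
  have hcont : Continuous fun b => ∫ t in (0)..b, h t :=
    intervalIntegral.continuous_primitive (fun _ _ => hi.intervalIntegrable) 0
  let r : StieltjesFunction ℝ :=
    { toFun := fun t => s t - ∫ u in (0)..t, h u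
      mono' := fun a b hab => by
        have := hs a b hab
        rw [hG a b hab] at this
        simp only
        linarith
      right_continuous' := fun t => (s.right_continuous t).sub hcont.continuousWithinAt }
  have hdiff : ∀ B : Set ℝ, ∫ t in B, h t =
      (∫⁻ t in B, ENNReal.ofReal (h t)).toReal - (∫⁻ t in B, ENNReal.ofReal (-h t)).toReal :=
    fun B => integral_eq_lintegral_pos_part_sub_lintegral_neg_part hi.integrableOn
  have hfp : ∀ B : Set ℝ, ∫⁻ t in B, ENNReal.ofReal (h t) ≠ ⊤ := fun B =>
    hi.integrableOn.lintegral_lt_top.ne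
  have hfn : ∀ B : Set ℝ, ∫⁻ t in B, ENNReal.ofReal (-h t) ≠ ⊤ := fun B =>
    hi.neg.integrableOn.lintegral_lt_top.ne
  -- Moving the negative part of `h` to the left avoids signed measures; two measures agreeing on
  -- half-open intervals coincide.
  have key : s.measure + volume.withDensity (fun t => ENNReal.ofReal (-h t)) =
      r.measure + volume.withDensity (fun t => ENNReal.ofReal (h t)) := by
    refine Measure.ext_of_Ioc' _ _ (fun a b _ => ?_) fun a b hab => ?_
    · rw [Measure.add_apply, withDensity_apply _ measurableSet_Ioc, StieltjesFunction.measure_Ioc]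
      exact ENNReal.add_ne_top.2 ⟨ENNReal.ofReal_ne_top, hfn _⟩
    rw [Measure.add_apply, Measure.add_apply, withDensity_apply _ measurableSet_Ioc,
      withDensity_apply _ measurableSet_Ioc, StieltjesFunction.measure_Ioc,
      StieltjesFunction.measure_Ioc, ← ENNReal.ofReal_toReal (hfp (Ioc a b)),
      ← ENNReal.ofReal_toReal (hfn (Ioc a b)),
      ← ENNReal.ofReal_add (sub_nonneg.2 (s.mono hab.le)) ENNReal.toReal_nonneg,
      ← ENNReal.ofReal_add (sub_nonneg.2 (r.mono hab.le)) ENNReal.toReal_nonneg]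
    congr 1
    have h1 := hdiff (Ioc a b)
    rw [hG a b hab.le] at h1
    change _ = (s b - ∫ u in (0)..b, h u) - (s a - ∫ u in (0)..a, h u) + _
    linarith
  have hA' := congrArg (fun m : Measure ℝ => m A) key
  simp only [Measure.add_apply, withDensity_apply _ hA] at hA'
  have hle : ∫⁻ t in A, ENNReal.ofReal (h t) ≤
      s.measure A + ∫⁻ t in A, ENNReal.ofReal (-h t) := by
    rw [hA']; exact le_add_self
  have := ENNReal.toReal_mono (ENNReal.add_ne_top.2 ⟨hfin, hfn A⟩) hle
  rw [ENNReal.toReal_add hfin (hfn A)] at this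
  rw [hdiff A, Measure.real]
  linarith

/-- The measure is built from `v` before `f` is given, so all functions dominated by `v` share it.
-/
theorem exists_measure_abs_setIntegral_le {v : ℝ → ℝ} (hv : MonotoneOn v (Icc 0 1)) :
    ∃ μ : Measure ℝ, IsFiniteMeasure μ ∧ μ univ ≤ ENNReal.ofReal (v 1 - v 0) ∧
      ∀ f : ℝ → ℝ, IntegrableOn f (Ioc 0 1) →
        (∀ a b, 0 ≤ a → a ≤ b → b ≤ 1 → |∫ t in Ioc a b, f t| ≤ v b - v a) →
        ∀ A, MeasurableSet A → A ⊆ Ioc 0 1 → |∫ t in A, f t| ≤ μ.real A := by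
  -- Clamping makes `v` constant beyond `1`, so passing to right limits adds no mass at the right
  -- endpoint.
  set k : ℝ → ℝ := fun t => max 0 (min t 1) with hk
  have hkm : Monotone k := fun a b hab => max_le_max le_rfl (min_le_min hab le_rfl)
  have hkI : ∀ t, k t ∈ Icc (0 : ℝ) 1 := fun t =>
    ⟨le_max_left _ _, max_le zero_le_one (min_le_right _ _)⟩
  have hw : Monotone (v ∘ k) := fun a b hab => hv (hkI a) (hkI b) (hkm hab)
  set s := hw.stieltjesFunction with hs
  have hfin : s.measure (Ioc 0 1) ≤ ENNReal.ofReal (v 1 - v 0) := by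
    rw [StieltjesFunction.measure_Ioc]
    refine ENNReal.ofReal_le_ofReal (sub_le_sub ?_ ?_)
    · have := hw.rightLim_le (x := 1) (y := 2) (by norm_num)
      rwa [Function.comp_apply, show k 2 = 1 by norm_num [hk]] at this
    · have := hw.le_rightLim (x := 0) le_rfl
      rwa [Function.comp_apply, show k 0 = 0 by norm_num [hk]] at this
  refine ⟨s.measure.restrict (Ioc 0 1), ⟨?_⟩, ?_, ?_⟩
  · rw [Measure.restrict_apply_univ]
    exact hfin.trans_lt ENNReal.ofReal_lt_top
  · simpa using hfin
  suffices H : ∀ f : ℝ → ℝ, IntegrableOn f (Ioc 0 1) →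
        (∀ a b, 0 ≤ a → a ≤ b → b ≤ 1 → |∫ t in Ioc a b, f t| ≤ v b - v a) →
        ∀ A, MeasurableSet A → A ⊆ Ioc 0 1 →
        ∫ t in A, f t ≤ (s.measure.restrict (Ioc 0 1)).real A by
    intro f hf hfv A hA hA1
    refine abs_le'.2 ⟨H f hf hfv A hA hA1, ?_⟩
    have := H (fun t => -f t) hf.neg (fun a b h0 hab h1 => by
      rw [integral_neg, abs_neg]; exact hfv a b h0 hab h1) A hA hA1
    rwa [integral_neg] at this
  intro f hf hfv A hA hA1
  set h : ℝ → ℝ := (Ioc 0 1).indicator f with hh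
  have hi : Integrable h := (integrable_indicator_iff measurableSet_Ioc).2 hf
  have hIoc : ∀ a b, Ioc 0 1 ∩ Ioc a b = Ioc (k a) (k b) := by
    intro a b
    ext t
    simp only [hk, mem_inter_iff, mem_Ioc, max_lt_iff, le_max_iff, le_min_iff, min_lt_iff]
    grind
  have hInt : ∀ B ⊆ Ioc (0 : ℝ) 1, ∫ t in B, h t = ∫ t in B, f t := by
    intro B hB
    rw [hh, setIntegral_indicator measurableSet_Ioc, inter_eq_left.2 hB]
  have hw' : ∀ a b, a ≤ b → ∫ t in Ioc a b, h t ≤ (v ∘ k) b - (v ∘ k) a := by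
    intro a b hab
    rw [hh, setIntegral_indicator measurableSet_Ioc, inter_comm, hIoc]
    exact (le_abs_self _).trans (hfv _ _ (hkI a).1 (hkm hab) (hkI b).2)
  have hG : ∀ a b, a ≤ b → ∫ t in Ioc a b, h t = (∫ t in (0)..b, h t) - ∫ t in (0)..a, h t := by
    intro a b hab
    rw [intervalIntegral.integral_interval_sub_left hi.intervalIntegrable hi.intervalIntegrable,
      intervalIntegral.integral_of_le hab]
  have hcont : Continuous fun b => ∫ t in (0)..b, h t :=
    intervalIntegral.continuous_primitive (fun _ _ => hi.intervalIntegrable) 0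
  have hshift : ∀ a : ℝ, Tendsto (fun e : ℝ => a + e) (𝓝[>] 0) (𝓝[>] a) := by
    intro a
    refine tendsto_nhdsWithin_iff.2 ⟨?_, ?_⟩
    · refine Tendsto.mono_left ?_ nhdsWithin_le_nhds
      exact (continuous_const.add continuous_id).tendsto' _ _ (by simp)
    · filter_upwards [self_mem_nhdsWithin] with e he
      simpa using he
  -- `v` need not be right-continuous: shift both endpoints right by `e` and let `e` tend to `0`,
  -- the primitive of `h` being continuous.
  have hsle : ∀ a b, a ≤ b → ∫ t in Ioc a b, h t ≤ s b - s a := by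
    intro a b hab
    rw [hG a b hab]
    have l1 : ∀ c, Tendsto (fun e => ∫ t in (0)..(c + e), h t) (𝓝[>] 0)
        (𝓝 (∫ t in (0)..c, h t)) := fun c =>
      ((hcont.tendsto c).mono_left nhdsWithin_le_nhds).comp (hshift c)
    have l2 : ∀ c, Tendsto (fun e => (v ∘ k) (c + e)) (𝓝[>] 0) (𝓝 (s c)) := fun c =>
      (hw.tendsto_rightLim c).comp (hshift c)
    refine le_of_tendsto_of_tendsto ((l1 b).sub (l1 a)) ((l2 b).sub (l2 a))
      (Eventually.of_forall fun e => ?_)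
    have := hw' (a + e) (b + e) (by linarith)
    rwa [hG _ _ (by linarith)] at this
  have hAfin : s.measure A ≠ ⊤ :=
    ((measure_mono hA1).trans hfin |>.trans_lt ENNReal.ofReal_lt_top).ne
  rw [← hInt A hA1, measureReal_restrict_apply hA, inter_eq_left.2 hA1]
  exact setIntegral_le_stieltjes_real hi hsle hA hAfin

end Variation


/-! ### Support functions, the Hausdorff metric and Hahn–Banach arguments. -/

section SupportFunctions

variable {X : Type*} [NormedAddCommGroup X] [NormedSpace ℝ X]

theorem bddAbove_image_of_isBounded (x : StrongDual ℝ X) {C : Set X}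
    (hC : Bornology.IsBounded C) : BddAbove ((fun v : X => x v) '' C) :=
  (x.lipschitz.isBounded_image hC).bddAbove

theorem le_supp (x : StrongDual ℝ X) {C : Set X} (hC : Bornology.IsBounded C) {v : X}
    (hv : v ∈ C) : x v ≤ supp x C :=
  le_csSup (bddAbove_image_of_isBounded x hC) (mem_image_of_mem _ hv)

theorem supp_le {x : StrongDual ℝ X} {C : Set X} (hne : C.Nonempty) {r : ℝ}
    (h : ∀ v ∈ C, x v ≤ r) : supp x C ≤ r := by
  refine csSup_le (hne.image _) ?_
  rintro _ ⟨v, hv, rfl⟩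
  exact h v hv

theorem supp_smul {c : ℝ} (hc : 0 ≤ c) (x : StrongDual ℝ X) (C : Set X) :
    supp (c • x) C = c * supp x C := by
  have : (fun v : X => (c • x) v) '' C = c • ((fun v : X => x v) '' C) := by
    rw [← image_smul, image_image]; rfl
  rw [supp, supp, this, Real.sSup_smul_of_nonneg hc, smul_eq_mul]

theorem supp_add_le (x y : StrongDual ℝ X) {C : Set X} (hne : C.Nonempty)
    (hC : Bornology.IsBounded C) : supp (x + y) C ≤ supp x C + supp y C :=
  supp_le hne fun _ hv => add_le_add (le_supp x hC hv) (le_supp y hC hv)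

theorem supp_closure (x : StrongDual ℝ X) {C : Set X} (hne : C.Nonempty)
    (hC : Bornology.IsBounded C) : supp x (closure C) = supp x C := by
  refine le_antisymm (supp_le hne.closure fun v hv => ?_)
    (supp_le hne fun v hv => le_supp x hC.closure (subset_closure hv))
  have : closure C ⊆ {w | x w ≤ supp x C} :=
    closure_minimal (fun w hw => le_supp x hC hw) (isClosed_le x.continuous continuous_const)
  exact this hv

theorem supp_convexHull (x : StrongDual ℝ X) {C : Set X} (hne : C.Nonempty)
    (hC : Bornology.IsBounded C) : supp x (convexHull ℝ C) = supp x C := by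
  refine le_antisymm (supp_le hne.convexHull fun v hv => ?_)
    (supp_le hne fun v hv => le_supp x (isBounded_convexHull.2 hC) (subset_convexHull ℝ C hv))
  have : convexHull ℝ C ⊆ {w | x w ≤ supp x C} :=
    convexHull_min (fun w hw => le_supp x hC hw)
      (convex_halfSpace_le x.toLinearMap.isLinear _)
  exact this hv

theorem supp_add (x : StrongDual ℝ X) {C D : Set X} (hCne : C.Nonempty) (hDne : D.Nonempty)
    (hC : Bornology.IsBounded C) (hD : Bornology.IsBounded D) :
    supp x (C + D) = supp x C + supp x D := by
  have : (fun v : X => x v) '' (C + D) = ((fun v : X => x v) '' C) + ((fun v : X => x v) '' D) :=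
    image_add x
  rw [supp, this, csSup_add (hCne.image _) (bddAbove_image_of_isBounded x hC) (hDne.image _)
    (bddAbove_image_of_isBounded x hD)]
  rfl

theorem supp_singleton_zero (x : StrongDual ℝ X) : supp x ({0} : Set X) = 0 := by
  simp [supp]

theorem sum_mem_and_supp_sum {ι : Type*} (T : Finset ι) {C : ι → Set X}
    (hC : ∀ i ∈ T, C i ∈ cb X) :
    (∑ i ∈ T, C i).Nonempty ∧ Convex ℝ (∑ i ∈ T, C i) ∧ Bornology.IsBounded (∑ i ∈ T, C i) ∧
      ∀ x : StrongDual ℝ X, supp x (∑ i ∈ T, C i) = ∑ i ∈ T, supp x (C i) := by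
  classical
  induction T using Finset.induction_on with
  | empty =>
    simp only [Finset.sum_empty]
    refine ⟨⟨0, rfl⟩, convex_zero, Bornology.isBounded_singleton, fun x => supp_singleton_zero x⟩
  | insert a T ha ih =>
    obtain ⟨h1, h2, h3, h4⟩ := ih fun i hi => hC i (Finset.mem_insert_of_mem hi)
    obtain ⟨k1, -, k3, k4⟩ := hC a (Finset.mem_insert_self _ _)
    simp only [Finset.sum_insert ha]
    exact ⟨k1.add h1, k3.add h2, k4.add h3, fun x => by rw [supp_add x k1 h1 k4 h3, h4]⟩

theorem closure_sum_mem_cb {ι : Type*} (T : Finset ι) {C : ι → Set X}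
    (hC : ∀ i ∈ T, C i ∈ cb X) : closure (∑ i ∈ T, C i) ∈ cb X := by
  obtain ⟨h1, h2, h3, -⟩ := sum_mem_and_supp_sum T hC
  exact ⟨h1.closure, isClosed_closure, h2.closure, h3.closure⟩

theorem supp_closure_sum {ι : Type*} (T : Finset ι) {C : ι → Set X}
    (hC : ∀ i ∈ T, C i ∈ cb X) (x : StrongDual ℝ X) :
    supp x (closure (∑ i ∈ T, C i)) = ∑ i ∈ T, supp x (C i) := by
  obtain ⟨h1, -, h3, h4⟩ := sum_mem_and_supp_sum T hC
  rw [supp_closure x h1 h3, h4]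

theorem supp_sub_le_hausdorffDist (x : StrongDual ℝ X) {C D : Set X} (hCne : C.Nonempty)
    (hDne : D.Nonempty) (hC : Bornology.IsBounded C) (hD : Bornology.IsBounded D) :
    supp x C - supp x D ≤ ‖x‖ * Metric.hausdorffDist C D := by
  have hfin := Metric.hausdorffEDist_ne_top_of_nonempty_of_bounded hCne hDne hC hD
  have key : ∀ r, Metric.hausdorffDist C D < r → supp x C - supp x D ≤ ‖x‖ * r := by
    intro r hr
    rw [sub_le_iff_le_add]
    refine supp_le hCne fun v hv => ?_
    obtain ⟨w, hw, hvw⟩ := Metric.exists_dist_lt_of_hausdorffDist_lt hv hr hfin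
    have h1 : x v - x w ≤ ‖x‖ * r := by
      rw [← map_sub]
      refine (le_abs_self _).trans ((x.le_opNorm _).trans ?_)
      rw [← dist_eq_norm]
      gcongr
    linarith [le_supp x hD hw]
  have hlim : Tendsto (fun r => ‖x‖ * r) (𝓝[>] (Metric.hausdorffDist C D))
      (𝓝 (‖x‖ * Metric.hausdorffDist C D)) :=
    ((continuous_const.mul continuous_id).tendsto _).mono_left nhdsWithin_le_nhds
  refine ge_of_tendsto hlim ?_
  filter_upwards [self_mem_nhdsWithin] with r hr using key r hr

theorem abs_supp_sub_le_hausdorffDist (x : StrongDual ℝ X) {C D : Set X} (hCne : C.Nonempty)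
    (hDne : D.Nonempty) (hC : Bornology.IsBounded C) (hD : Bornology.IsBounded D) :
    |supp x C - supp x D| ≤ ‖x‖ * Metric.hausdorffDist C D := by
  refine abs_le'.2 ⟨supp_sub_le_hausdorffDist x hCne hDne hC hD, ?_⟩
  rw [neg_sub, Metric.hausdorffDist_comm]
  exact supp_sub_le_hausdorffDist x hDne hCne hD hC

theorem abs_supp_le_hausdorffDist_zero (x : StrongDual ℝ X) {C : Set X} (hCne : C.Nonempty)
    (hC : Bornology.IsBounded C) : |supp x C| ≤ ‖x‖ * Metric.hausdorffDist C {0} := by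
  have := abs_supp_sub_le_hausdorffDist x hCne (singleton_nonempty 0) hC
    Bornology.isBounded_singleton
  rwa [supp_singleton_zero, sub_zero] at this

/-- A point whose value under every functional exceeds the support function of the convex set `D`
by at most `ε` times the norm lies within `ε` of `D`. -/
theorem infDist_le_of_forall_le_supp {D : Set X} (hDne : D.Nonempty) (hDc : Convex ℝ D)
    {ε : ℝ} (hε : 0 ≤ ε) {v : X} (h : ∀ x : StrongDual ℝ X, x v ≤ supp x D + ε * ‖x‖) :
    Metric.infDist v D ≤ ε := by
  by_contra hcon
  push Not at hcon
  obtain ⟨r, hεr, hr⟩ := exists_between hcon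
  have hr0 : 0 < r := hε.trans_lt hεr
  have hdisj : Disjoint (Metric.ball v (Metric.infDist v D)) D := by
    rw [Set.disjoint_left]
    intro w hw hwD
    have := Metric.infDist_le_dist_of_mem (x := v) hwD
    rw [Metric.mem_ball, dist_comm] at hw
    linarith
  obtain ⟨f, u, hfu, huf⟩ := geometric_hahn_banach_open (convex_ball _ _) Metric.isOpen_ball hDc
    hdisj
  have hv : f v < u := hfu v (Metric.mem_ball_self (hr0.trans hr))
  have hnorm : ‖f‖ ≤ (u - f v) / r := by
    refine ContinuousLinearMap.opNorm_le_of_unit_norm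
      (div_nonneg (sub_nonneg.2 hv.le) hr0.le) fun z hz => ?_
    -- The ball around `v` contains `v + r • w`, so separation bounds the norm of `f` by the gap `u
    -- - f v` divided by `r`.
    have hz' : ∀ w : X, ‖w‖ = 1 → f w ≤ (u - f v) / r := by
      intro w hw
      have := hfu (v + r • w) (by
        rwa [Metric.mem_ball, dist_eq_norm, add_sub_cancel_left, norm_smul, hw, mul_one,
          Real.norm_of_nonneg hr0.le])
      rw [map_add, map_smul, smul_eq_mul] at this
      rw [le_div_iff₀ hr0]
      linarith
    rw [Real.norm_eq_abs]
    refine abs_le'.2 ⟨hz' z hz, ?_⟩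
    rw [← map_neg]
    exact hz' (-z) (by rwa [norm_neg])
  rw [le_div_iff₀ hr0] at hnorm
  -- Testing with `-f` gives `u - f v ≤ ε * ‖f‖`. With `r * ‖f‖ ≤ u - f v` and `ε < r` this forces
  -- `f = 0`, which separates nothing.
  have h1 := h (-f)
  have h2 : supp (-f) D ≤ -u := supp_le hDne fun b hb => neg_le_neg (huf b hb)
  rw [norm_neg, neg_apply] at h1
  have h3 : ‖f‖ = 0 := by
    by_contra h0
    have : 0 < ‖f‖ := lt_of_le_of_ne (norm_nonneg _) (Ne.symm h0)
    nlinarith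
  obtain ⟨b, hb⟩ := hDne
  have h4 := huf b hb
  rw [norm_eq_zero] at h3
  subst h3
  simp only [zero_apply] at hv h4
  linarith

theorem infDist_le_of_abs_supp_sub_le {C D : Set X}
    (hDne : D.Nonempty) (hC : Bornology.IsBounded C) (hDc : Convex ℝ D) {ε : ℝ} (hε : 0 ≤ ε)
    (h : ∀ x : StrongDual ℝ X, |supp x C - supp x D| ≤ ε * ‖x‖) {v : X} (hv : v ∈ C) :
    Metric.infDist v D ≤ ε :=
  infDist_le_of_forall_le_supp hDne hDc hε fun x => by
    linarith [le_supp x hC hv, (le_abs_self _).trans (h x)]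

theorem hausdorffDist_le_of_abs_supp_sub_le {C D : Set X} (hC : C ∈ cb X) (hD : D ∈ cb X)
    {ε : ℝ} (hε : 0 ≤ ε) (h : ∀ x : StrongDual ℝ X, |supp x C - supp x D| ≤ ε * ‖x‖) :
    Metric.hausdorffDist C D ≤ ε :=
  Metric.hausdorffDist_le_of_infDist hε
    (fun _ hv => infDist_le_of_abs_supp_sub_le hD.1 hC.2.2.2 hD.2.2.1 hε h hv)
    (fun _ hv => infDist_le_of_abs_supp_sub_le hC.1 hD.2.2.2 hC.2.2.1 hε
      (fun x => by rw [abs_sub_comm]; exact h x) hv)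

/-- Convergence of support functions uniformly on the unit ball makes the sets Cauchy in the
complete Hausdorff metric on closed sets. -/
theorem exists_mem_cb_of_tendsto_supp [CompleteSpace X] {C : ℕ → Set X} (hC : ∀ n, C n ∈ cb X)
    {p : StrongDual ℝ X → ℝ} {e : ℕ → ℝ} (he : Tendsto e atTop (𝓝 0))
    (h : ∀ n x, |supp x (C n) - p x| ≤ e n * ‖x‖) :
    ∃ L ∈ cb X, ∀ x, supp x L = p x := by
  let S : ℕ → TopologicalSpace.Closeds X := fun n => ⟨C n, (hC n).2.1⟩
  have hfin : ∀ n m, Metric.hausdorffEDist (C n) (C m) ≠ ⊤ := fun n m =>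
    Metric.hausdorffEDist_ne_top_of_nonempty_of_bounded (hC n).1 (hC m).1 (hC n).2.2.2 (hC m).2.2.2
  have hdist : ∀ n m, Metric.hausdorffEDist (C n) (C m) ≤ ENNReal.ofReal (|e n| + |e m|) := by
    intro n m
    rw [← ENNReal.ofReal_toReal (hfin n m)]
    refine ENNReal.ofReal_le_ofReal (hausdorffDist_le_of_abs_supp_sub_le (hC n) (hC m)
      (by positivity) fun x => ?_)
    have h1 := (h n x).trans (mul_le_mul_of_nonneg_right (le_abs_self _) (norm_nonneg x))
    have h2 := (h m x).trans (mul_le_mul_of_nonneg_right (le_abs_self _) (norm_nonneg x))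
    calc |supp x (C n) - supp x (C m)| = |(supp x (C n) - p x) - (supp x (C m) - p x)| := by
          congr 1; ring
      _ ≤ |supp x (C n) - p x| + |supp x (C m) - p x| := abs_sub _ _
      _ ≤ (|e n| + |e m|) * ‖x‖ := by rw [add_mul]; exact add_le_add h1 h2
  have hcauchy : CauchySeq S := by
    rw [EMetric.cauchySeq_iff]
    intro δ hδ
    obtain ⟨r, hr, hrδ⟩ := ENNReal.lt_iff_exists_nnreal_btwn.1 hδ
    have hr0 : (0 : ℝ) < r := by simpa using hr
    have hev : ∀ᶠ n in atTop, |e n| < r / 2 := by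
      have := he.abs
      rw [abs_zero] at this
      exact this.eventually (gt_mem_nhds (by positivity))
    obtain ⟨N, hN⟩ := eventually_atTop.1 hev
    refine ⟨N, fun m hm n hn => lt_of_le_of_lt (hdist m n) (lt_of_le_of_lt ?_ hrδ)⟩
    rw [← ENNReal.ofReal_coe_nnreal]
    exact ENNReal.ofReal_le_ofReal (by linarith [hN m hm, hN n hn])
  obtain ⟨L, hL⟩ := cauchySeq_tendsto_of_complete hcauchy
  have hLd : Tendsto (fun n => Metric.hausdorffEDist (C n) (L : Set X)) atTop (𝓝 0) :=
    tendsto_iff_edist_tendsto_0.1 hL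
  obtain ⟨N, hN⟩ := (hLd.eventually (gt_mem_nhds (zero_lt_one))).exists
  have hLne : (L : Set X).Nonempty :=
    Metric.nonempty_of_hausdorffEDist_ne_top (hC N).1 (hN.trans ENNReal.one_lt_top).ne
  have hLb : Bornology.IsBounded (L : Set X) := by
    refine ((hC N).2.2.2.thickening (δ := 1)).subset fun v hv => ?_
    rw [Metric.hausdorffEDist_comm] at hN
    obtain ⟨w, hw, hvw⟩ := Metric.exists_edist_lt_of_hausdorffEDist_lt hv hN
    rw [Metric.mem_thickening_iff]
    refine ⟨w, hw, ?_⟩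
    rwa [edist_dist, ENNReal.ofReal_lt_one] at hvw
  -- The closed convex hull has the same support function as `L`, so convexity of the limit itself
  -- need not be checked.
  refine ⟨closure (convexHull ℝ (L : Set X)), ⟨hLne.convexHull.closure, isClosed_closure,
    (convex_convexHull ℝ _).closure, (isBounded_convexHull.2 hLb).closure⟩, fun x => ?_⟩
  rw [supp_closure x hLne.convexHull (isBounded_convexHull.2 hLb), supp_convexHull x hLne hLb]
  have t1 : Tendsto (fun n => supp x (C n)) atTop (𝓝 (supp x (L : Set X))) := by
    rw [tendsto_iff_dist_tendsto_zero]
    have hLd' : Tendsto (fun n => Metric.hausdorffDist (C n) (L : Set X)) atTop (𝓝 0) := by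
      exact (ENNReal.tendsto_toReal ENNReal.zero_ne_top).comp hLd
    refine squeeze_zero (fun _ => dist_nonneg) (fun n => ?_)
      (by simpa using hLd'.const_mul ‖x‖)
    rw [Real.dist_eq]
    exact abs_supp_sub_le_hausdorffDist x (hC n).1 hLne (hC n).2.2.2 hLb
  have t2 : Tendsto (fun n => supp x (C n)) atTop (𝓝 (p x)) := by
    rw [tendsto_iff_dist_tendsto_zero]
    exact squeeze_zero (fun _ => dist_nonneg) (fun n => h n x) (by simpa using he.mul_const ‖x‖)
  exact tendsto_nhds_unique t1 t2

/-- A bounded sublinear functional on `X*` is the support function of a nonempty convex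
weak*-compact subset of the bidual. -/
theorem exists_mem_cwstark_of_sublinear {p : StrongDual ℝ X → ℝ} {B : ℝ}
    (hsmul : ∀ c : ℝ, 0 ≤ c → ∀ x, p (c • x) = c * p x) (hadd : ∀ x y, p (x + y) ≤ p x + p y)
    (hB : ∀ x, |p x| ≤ B * ‖x‖) :
    ∃ K ∈ cwstark X, ∀ x, suppBidual x K = p x := by
  have hp0 : p 0 = 0 := by simpa using hsmul 0 le_rfl 0
  have hBmax : ∀ x, |p x| ≤ max B 0 * ‖x‖ := fun x =>
    (hB x).trans (mul_le_mul_of_nonneg_right (le_max_left _ _) (norm_nonneg _))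
  set K : Set (WeakDual ℝ (StrongDual ℝ X)) := {z | ∀ x, z x ≤ p x} with hK
  have hattain : ∀ x, ∃ z ∈ K, z x = p x := by
    intro x
    have H : ∀ c : ℝ, c • x = 0 → c • p x = 0 := by
      intro c hc
      rcases smul_eq_zero.1 hc with h | h
      · simp [h]
      · simp [h, hp0]
    obtain ⟨g, hg1, hg2⟩ := exists_extension_of_le_sublinear
      (LinearPMap.mkSpanSingleton' (σ := RingHom.id ℝ) x (p x) H) p (fun c hc => hsmul c hc.le) hadd
      (by
        rintro ⟨y, hy⟩
        obtain ⟨c, rfl⟩ := Submodule.mem_span_singleton.1 hy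
        rw [LinearPMap.mkSpanSingleton'_apply]
        simp only [RingHom.id_apply, smul_eq_mul]
        rcases le_total 0 c with hc | hc
        · exact (hsmul c hc x).ge
        -- For negative `c`, subadditivity gives `0 = p 0 ≤ p (c • x) + (-c) * p x`.
        · have h1 := hadd (c • x) ((-c) • x)
          rw [← add_smul, add_neg_cancel, zero_smul, hp0, hsmul (-c) (neg_nonneg.2 hc)] at h1
          linarith)
    have hgb : ∀ y, ‖g y‖ ≤ max B 0 * ‖y‖ := by
      intro y
      rw [Real.norm_eq_abs]
      refine abs_le'.2 ⟨(hg2 y).trans ((le_abs_self _).trans (hBmax y)), ?_⟩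
      rw [← map_neg, ← norm_neg y]
      exact (hg2 (-y)).trans ((le_abs_self _).trans (hBmax (-y)))
    refine ⟨StrongDual.toWeakDual (g.mkContinuous (max B 0) hgb), fun y => hg2 y, ?_⟩
    exact (hg1 ⟨x, Submodule.mem_span_singleton_self x⟩).trans
      (LinearPMap.mkSpanSingleton'_apply_self (σ := RingHom.id ℝ) x (p x) H _)
  have hclosed : IsClosed K := by
    rw [hK, ofPred_forall]
    exact isClosed_iInter fun x => isClosed_le (WeakDual.eval_continuous x) continuous_const
  have hsub : K ⊆ WeakDual.toStrongDual ⁻¹' Metric.closedBall 0 (max B 0) := by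
    intro z hz
    refine mem_preimage.2
      ((mem_closedBall_zero_iff (E := StrongDual ℝ (StrongDual ℝ X))).2 ?_)
    refine ContinuousLinearMap.opNorm_le_bound _ (le_max_right _ _) fun y => ?_
    rw [Real.norm_eq_abs]
    refine abs_le'.2 ⟨(hz y).trans ((le_abs_self _).trans (hBmax y)), ?_⟩
    rw [← map_neg, ← norm_neg y]
    exact (hz (-y)).trans ((le_abs_self _).trans (hBmax (-y)))
  refine ⟨K, ⟨(hattain 0).imp fun z hz => hz.1, ?_,
    (WeakDual.isCompact_closedBall 0 (max B 0)).of_isClosed_subset hclosed hsub⟩, fun x => ?_⟩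
  · intro z hz w hw a b ha hb hab x
    have h1 := mul_le_mul_of_nonneg_left (hz x) ha
    have h2 := mul_le_mul_of_nonneg_left (hw x) hb
    calc (a • z + b • w) x = a * z x + b * w x := rfl
      _ ≤ a * p x + b * p x := add_le_add h1 h2
      _ = p x := by rw [← add_mul, hab, one_mul]
  · obtain ⟨z, hz, hzx⟩ := hattain x
    refine IsGreatest.csSup_eq ⟨⟨z, hz, hzx⟩, ?_⟩
    rintro _ ⟨w, hw, rfl⟩
    exact hw x

end SupportFunctions


/-! ### From scalar integrals to set-valued integrals. -/

section Integrals

variable {X : Type*} [NormedAddCommGroup X] [NormedSpace ℝ X]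

theorem hasHKIntegral_of_integrableOn {f : ℝ → ℝ} (I : Subinterval)
    (hf : IntegrableOn f (Ioc I.left I.right)) :
    HasHKIntegral f I (∫ t in Ioc I.left I.right, f t) := by
  have hmp : MeasurePreserving (MeasurableEquiv.funUnique (Fin 1) ℝ) :=
    volume_preserving_funUnique (Fin 1) ℝ
  have hpre : (I.toBox : Set (Fin 1 → ℝ)) =
      (MeasurableEquiv.funUnique (Fin 1) ℝ) ⁻¹' Ioc I.left I.right := by
    ext x
    simp [Subinterval.toBox, BoxIntegral.Box.mem_def]
  have h1 : IntegrableOn (fun x : Fin 1 → ℝ => f (x 0)) I.toBox := by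
    rw [hpre]
    exact (hmp.integrableOn_comp_preimage (MeasurableEquiv.measurableEmbedding _)).2 hf
  have h2 := h1.hasBoxIntegral BoxIntegral.IntegrationParams.Henstock rfl
  have h3 : ∫ x in (I.toBox : Set (Fin 1 → ℝ)), f (x 0) = ∫ t in Ioc I.left I.right, f t := by
    rw [hpre]
    exact hmp.setIntegral_preimage_emb (MeasurableEquiv.measurableEmbedding _) f _
  rw [h3] at h2
  exact h2

/-- Discarding a null set, including possibly the point `0`, fits `A` to the half-open intervals
that generate the dominating measures. -/
theorem exists_measurable_subset_ae_eq_of_mem_lebesgueSets {A : Set ℝ} (hA : A ∈ lebesgueSets) :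
    ∃ B ⊆ A, B ⊆ Ioc 0 1 ∧ MeasurableSet B ∧ B =ᵐ[volume] A := by
  obtain ⟨B, hBA, hBm, hB⟩ := (hA.2.inter
    (measurableSet_Ioc (a := (0 : ℝ)) (b := 1)).nullMeasurableSet).exists_measurable_subset_ae_eq
  refine ⟨B, hBA.trans inter_subset_left, hBA.trans inter_subset_right, hBm, hB.trans ?_⟩
  have h1 : (A ∩ Ioc 0 1 : Set ℝ) =ᵐ[volume] (A ∩ Icc 0 1 : Set ℝ) :=
    (ae_eq_refl A).inter Ioc_ae_eq_Icc
  rwa [inter_eq_left.2 hA.1] at h1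

theorem abs_le_mul_norm_of_smul {p : StrongDual ℝ X → ℝ} {B : ℝ}
    (hsmul : ∀ c : ℝ, 0 ≤ c → ∀ x, p (c • x) = c * p x)
    (hB : ∀ x, ‖x‖ ≤ 1 → |p x| ≤ B) (x : StrongDual ℝ X) : |p x| ≤ B * ‖x‖ := by
  rcases eq_or_ne x 0 with rfl | hx
  · simpa using hsmul 0 le_rfl 0
  · have hx' : ‖x‖ ≠ 0 := norm_ne_zero_iff.2 hx
    have h1 : x = ‖x‖ • (‖x‖⁻¹ • x) := by rw [smul_smul, mul_inv_cancel₀ hx', one_smul]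
    have h2 := hB (‖x‖⁻¹ • x) (by rw [norm_smul, norm_inv, norm_norm, inv_mul_cancel₀ hx'])
    rw [h1, hsmul _ (norm_nonneg _), abs_mul, abs_norm, ← h1, mul_comm]
    exact mul_le_mul_of_nonneg_right h2 (norm_nonneg _)

theorem setIntegral_supp_smul (Γ : ℝ → Set X) (A : Set ℝ) (c : ℝ) (hc : 0 ≤ c)
    (x : StrongDual ℝ X) : ∫ t in A, supp (c • x) (Γ t) = c * ∫ t in A, supp x (Γ t) := by
  simp_rw [supp_smul hc]
  exact integral_const_mul _ _

variable {Γ : ℝ → Set X} {Φ : Subinterval → Set X}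

theorem IsDKPIntegral.integrableOn_and_supp_eq (hΦ : IsDKPIntegral Γ Φ) {x : StrongDual ℝ X}
    {v : ℝ → ℝ} (hv : ∀ I : Subinterval, |supp x (Φ I)| ≤ v I.right - v I.left) :
    IntegrableOn (fun t => supp x (Γ t)) (Icc 0 1) ∧
      ∀ I : Subinterval, ∫ t in Ioc I.left I.right, supp x (Γ t) = supp x (Φ I) := by
  obtain ⟨F, hF, hFΦ⟩ := hΦ.2 x
  have := hF.integrableOn_and_integral_eq (v := v) fun a b ha hab hb => by
    have := hv ⟨a, b, ha, hab, hb⟩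
    rwa [hFΦ] at this
  refine ⟨this.1, fun I => ?_⟩
  rw [this.2 _ _ I.zero_le_left I.left_lt_right.le I.right_le_one, hFΦ]

/-- Scalar integrability and the integral formula extend from the unit ball to the whole dual. -/
theorem integrableOn_and_supp_eq_of_closedBall
    (h : ∀ x : StrongDual ℝ X, ‖x‖ ≤ 1 → IntegrableOn (fun t => supp x (Γ t)) (Icc 0 1) ∧
      ∀ I : Subinterval, ∫ t in Ioc I.left I.right, supp x (Γ t) = supp x (Φ I))
    (x : StrongDual ℝ X) : IntegrableOn (fun t => supp x (Γ t)) (Icc 0 1) ∧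
      ∀ I : Subinterval, ∫ t in Ioc I.left I.right, supp x (Γ t) = supp x (Φ I) := by
  rcases eq_or_ne x 0 with rfl | hx
  · exact h 0 (by simp)
  · have hx' : ‖x‖ ≠ 0 := norm_ne_zero_iff.2 hx
    have h1 : x = ‖x‖ • (‖x‖⁻¹ • x) := by rw [smul_smul, mul_inv_cancel₀ hx', one_smul]
    obtain ⟨h2, h3⟩ := h (‖x‖⁻¹ • x)
      (by rw [norm_smul, norm_inv, norm_norm, inv_mul_cancel₀ hx'])
    rw [h1]
    generalize ‖x‖⁻¹ • x = y at h2 h3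
    refine ⟨?_, fun I => ?_⟩
    · simp_rw [supp_smul (norm_nonneg x)]
      exact h2.const_mul _
    · rw [setIntegral_supp_smul _ _ _ (norm_nonneg x), supp_smul (norm_nonneg x), h3]

/-- The measure precedes the functional: one `μ` serves every `x` dominated by `v`, as Hausdorff
convergence requires. -/
theorem exists_measure_abs_setIntegral_supp_le {v : ℝ → ℝ}
    (hv : ∀ I : Subinterval, 0 ≤ v I.right - v I.left) :
    ∃ μ : Measure ℝ, IsFiniteMeasure μ ∧ μ univ ≤ ENNReal.ofReal (v 1 - v 0) ∧
      ∀ x : StrongDual ℝ X, IntegrableOn (fun t => supp x (Γ t)) (Icc 0 1) →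
        (∀ I : Subinterval, ∫ t in Ioc I.left I.right, supp x (Γ t) = supp x (Φ I)) →
        (∀ I : Subinterval, |supp x (Φ I)| ≤ v I.right - v I.left) →
        ∀ A, MeasurableSet A → A ⊆ Ioc 0 1 → |∫ t in A, supp x (Γ t)| ≤ μ.real A := by
  have hmono : MonotoneOn v (Icc 0 1) := by
    intro a ha b hb hab
    rcases hab.eq_or_lt with rfl | hab
    · rfl
    · exact sub_nonneg.1 (hv ⟨a, b, ha.1, hab, hb.2⟩)
  obtain ⟨μ, hμ, hμ1, h⟩ := exists_measure_abs_setIntegral_le hmono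
  refine ⟨μ, hμ, hμ1, fun x hi hx hvx A hA hA1 =>
    h _ (hi.mono_set Ioc_subset_Icc_self) (fun a b ha hab hb => ?_) A hA hA1⟩
  rcases hab.eq_or_lt with rfl | hab
  · simp
  · have := hvx ⟨a, b, ha, hab, hb⟩
    rwa [← hx ⟨a, b, ha, hab, hb⟩] at this

theorem IsDKPIntegral.weaklyMcShaneIntegrable_and_gelfandIntegrable
    (hΓ : ∀ t ∈ Icc (0 : ℝ) 1, Γ t ∈ cb X) (hΦ : IsDKPIntegral Γ Φ)
    (hvar : (⨆ x ∈ Metric.closedBall (0 : StrongDual ℝ X) 1,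
      intervalVariation (fun I => supp x (Φ I))) < ⊤) :
    WeaklyMcShaneIntegrable Γ ∧ GelfandIntegrable Γ := by
  set W := ⨆ x ∈ Metric.closedBall (0 : StrongDual ℝ X) 1,
      intervalVariation (fun I => supp x (Φ I)) with hW
  have hx : ∀ x : StrongDual ℝ X, ‖x‖ ≤ 1 → ∃ v : ℝ → ℝ,
      (∀ I : Subinterval, |supp x (Φ I)| ≤ v I.right - v I.left) ∧ v 1 - v 0 ≤ W.toReal := by
    intro x hx
    have hle : intervalVariation (fun I => supp x (Φ I)) ≤ W :=
      le_iSup₂ (f := fun (x : StrongDual ℝ X) (_ : x ∈ Metric.closedBall 0 1) =>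
        intervalVariation (fun I => supp x (Φ I))) x (mem_closedBall_zero_iff.2 hx)
    obtain ⟨v, hv, hv1⟩ := exists_abs_le_sub_of_intervalVariation_lt_top (hle.trans_lt hvar)
    exact ⟨v, hv, hv1.trans (ENNReal.toReal_mono hvar.ne hle)⟩
  have hball : ∀ x : StrongDual ℝ X, ‖x‖ ≤ 1 →
      IntegrableOn (fun t => supp x (Γ t)) (Icc 0 1) ∧
      ∀ I : Subinterval, ∫ t in Ioc I.left I.right, supp x (Γ t) = supp x (Φ I) := by
    intro x h1
    obtain ⟨v, hv, -⟩ := hx x h1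
    exact hΦ.integrableOn_and_supp_eq hv
  have hall := integrableOn_and_supp_eq_of_closedBall hball
  have hscalar : ScalarlyIntegrable Γ := fun x => (hall x).1
  -- The measure varies with `x`, but its total mass never exceeds `W`.
  have hbound : ∀ A ∈ lebesgueSets, ∀ x : StrongDual ℝ X, ‖x‖ ≤ 1 →
      |∫ t in A, supp x (Γ t)| ≤ W.toReal := by
    intro A hA x h1
    obtain ⟨v, hv, hvW⟩ := hx x h1
    obtain ⟨μ, _, hμ, h⟩ := exists_measure_abs_setIntegral_supp_le (Γ := Γ) (Φ := Φ)
      fun I => (abs_nonneg _).trans (hv I)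
    obtain ⟨B, -, hB1, hBm, hBA⟩ := exists_measurable_subset_ae_eq_of_mem_lebesgueSets hA
    rw [← setIntegral_congr_set hBA]
    refine (h x (hball x h1).1 (hball x h1).2 hv B hBm hB1).trans ?_
    refine ENNReal.toReal_le_of_le_ofReal ENNReal.toReal_nonneg ?_
    exact (measure_mono (subset_univ B)).trans (hμ.trans (ENNReal.ofReal_le_ofReal hvW))
  refine ⟨⟨⟨Φ, hΦ.1, fun x I => ?_⟩, hscalar⟩, hscalar, ?_⟩
  · rw [← (hall x).2 I]
    exact hasHKIntegral_of_integrableOn I ((hscalar x).mono_set (Ioc_subset_Icc_self.trans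
      (Icc_subset_Icc I.zero_le_left I.right_le_one)))
  · have hex : ∀ A : Set ℝ, ∃ K : Set (WeakDual ℝ (StrongDual ℝ X)), A ∈ lebesgueSets →
        K ∈ cwstark X ∧ ∀ x, suppBidual x K = ∫ t in A, supp x (Γ t) := by
      intro A
      by_cases hA : A ∈ lebesgueSets
      · obtain ⟨K, hK, hK'⟩ := exists_mem_cwstark_of_sublinear
          (p := fun x => ∫ t in A, supp x (Γ t)) (setIntegral_supp_smul Γ A) (fun x y => by
            have hi : ∀ x : StrongDual ℝ X, IntegrableOn (fun t => supp x (Γ t)) A :=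
              fun x => (hscalar x).mono_set hA.1
            rw [← integral_add (hi x) (hi y)]
            refine integral_mono_ae (hi (x + y)) ((hi x).add (hi y)) ?_
            refine (ae_restrict_iff'₀ hA.2).2 (Eventually.of_forall fun t ht => ?_)
            have := hΓ t (hA.1 ht)
            exact supp_add_le x y this.1 this.2.2.2)
          (abs_le_mul_norm_of_smul (setIntegral_supp_smul Γ A) (hbound A hA))
        exact ⟨K, fun _ => ⟨hK, hK'⟩⟩
      · exact ⟨∅, fun h => absurd h hA⟩
    choose M hM using hex
    exact ⟨M, hM⟩

/-! ### Constructing the strong Pettis integral by approximation in measure. -/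

section Pettis

variable {f : StrongDual ℝ X → ℝ → ℝ} {μ : Measure ℝ}

/-- The integrals over `S n` and `A` differ by integrals over the two set differences, hence by at
most the measure of the symmetric difference times `‖x‖`. -/
theorem exists_mem_cb_of_tendsto_measure [CompleteSpace X] [IsFiniteMeasure μ]
    (hf : ∀ x, IntegrableOn (f x) (Ioc 0 1))
    (hμ : ∀ x A, MeasurableSet A → A ⊆ Ioc 0 1 → |∫ t in A, f x t| ≤ μ.real A * ‖x‖)
    {A : Set ℝ} {S : ℕ → Set ℝ} (hA : MeasurableSet A) (hA1 : A ⊆ Ioc 0 1)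
    (hS : ∀ n, MeasurableSet (S n)) (hS1 : ∀ n, S n ⊆ Ioc 0 1)
    (h1 : Tendsto (fun n => μ (S n \ A)) atTop (𝓝 0))
    (h2 : Tendsto (fun n => μ (A \ S n)) atTop (𝓝 0))
    (hC : ∀ n, ∃ C ∈ cb X, ∀ x, supp x C = ∫ t in S n, f x t) :
    ∃ C ∈ cb X, ∀ x, supp x C = ∫ t in A, f x t := by
  choose C hC hCs using hC
  have t1 := (ENNReal.tendsto_toReal ENNReal.zero_ne_top).comp h1
  have t2 := (ENNReal.tendsto_toReal ENNReal.zero_ne_top).comp h2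
  refine exists_mem_cb_of_tendsto_supp hC (e := fun n => μ.real (S n \ A) + μ.real (A \ S n))
    (by simpa [Measure.real] using t1.add t2) fun n x => ?_
  have i1 : ∫ t in S n, f x t = (∫ t in S n ∩ A, f x t) + ∫ t in S n \ A, f x t :=
    (integral_inter_add_sdiff hA ((hf x).mono_set (hS1 n))).symm
  have i2 : ∫ t in A, f x t = (∫ t in A ∩ S n, f x t) + ∫ t in A \ S n, f x t :=
    (integral_inter_add_sdiff (hS n) ((hf x).mono_set hA1)).symm
  rw [hCs, i1, i2, inter_comm A, add_sub_add_left_eq_sub, add_mul]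
  exact (abs_sub _ _).trans (add_le_add
    (hμ x _ ((hS n).diff hA) (sdiff_subset.trans (hS1 n)))
    (hμ x _ (hA.diff (hS n)) (sdiff_subset.trans hA1)))

theorem exists_mem_cb_biUnion (hf : ∀ x, IntegrableOn (f x) (Ioc 0 1))
    (hΦ : ∀ I, Φ I ∈ cb X)
    (hΦf : ∀ x (I : Subinterval), ∫ t in Ioc I.left I.right, f x t = supp x (Φ I))
    {ι : Type*} (T : Finset ι) (I : ι → Subinterval)
    (hT : (T : Set ι).PairwiseDisjoint fun i => Ioc (I i).left (I i).right) :
    ∃ C ∈ cb X, ∀ x, supp x C = ∫ t in ⋃ i ∈ T, Ioc (I i).left (I i).right, f x t := by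
  refine ⟨closure (∑ i ∈ T, Φ (I i)), closure_sum_mem_cb T fun i _ => hΦ _, fun x => ?_⟩
  rw [supp_closure_sum T fun i _ => hΦ _, integral_biUnion_finset T
    (fun _ _ => measurableSet_Ioc) hT fun i _ => (hf x).mono_set
      (Ioc_subset_Ioc (I i).zero_le_left (I i).right_le_one)]
  exact Finset.sum_congr rfl fun i _ => (hΦf x (I i)).symm

/-- The `k`-th interval of the partition of `[0,1]` into `n + 1` intervals of equal length. -/
def gridInterval (n : ℕ) (k : Fin (n + 1)) : Subinterval where
  left := (k : ℝ) / (n + 1)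
  right := ((k : ℝ) + 1) / (n + 1)
  zero_le_left := by positivity
  left_lt_right := by gcongr; linarith
  right_le_one := by
    rw [div_le_one (by positivity)]
    exact_mod_cast k.2

theorem gridInterval_pairwise_disjoint (n : ℕ) :
    Pairwise fun j k : Fin (n + 1) => Disjoint
      (Ioc (gridInterval n j).left (gridInterval n j).right)
      (Ioc (gridInterval n k).left (gridInterval n k).right) := by
  have key : ∀ j k : Fin (n + 1), j < k → Disjoint
      (Ioc (gridInterval n j).left (gridInterval n j).right)
      (Ioc (gridInterval n k).left (gridInterval n k).right) := by
    intro j k hjk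
    rw [Set.disjoint_left]
    intro t hj hk
    have h1 : (gridInterval n j).right ≤ (gridInterval n k).left := by
      simp only [gridInterval]
      gcongr
      exact_mod_cast hjk
    exact absurd hk.1 (not_lt.2 (hj.2.trans h1))
  intro j k hjk
  rcases lt_or_gt_of_ne hjk with h | h
  · exact key j k h
  · exact (key k j h).symm

theorem exists_mem_gridInterval (n : ℕ) {t : ℝ} (ht : t ∈ Ioc (0 : ℝ) 1) :
    ∃ k, t ∈ Ioc (gridInterval n k).left (gridInterval n k).right := by
  have hn : (0 : ℝ) < n + 1 := by positivity
  have hpos : 0 < ⌈t * (n + 1)⌉₊ := Nat.ceil_pos.2 (mul_pos ht.1 hn)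
  have hle : ⌈t * (n + 1)⌉₊ ≤ n + 1 := by
    refine Nat.ceil_le.2 ?_
    push_cast
    nlinarith [ht.2]
  -- Cells are open on the left, so the index is the ceiling minus one, and `t > 0` makes the
  -- ceiling positive.
  refine ⟨⟨⌈t * (n + 1)⌉₊ - 1, by omega⟩, ?_, ?_⟩
  · simp only [gridInterval]
    rw [div_lt_iff₀ hn, Nat.cast_sub hpos, Nat.cast_one]
    linarith [Nat.ceil_lt_add_one (mul_pos ht.1 hn).le]
  · simp only [gridInterval]
    rw [le_div_iff₀ hn, Nat.cast_sub hpos, Nat.cast_one, sub_add_cancel]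
    exact Nat.le_ceil _

/-- `U` is approximated from inside by the grid cells it contains. Each point of `U` in `(0,1]` is
eventually covered, and pointwise convergence of indicators suffices for a finite measure. -/
theorem exists_mem_cb_isOpen_inter [CompleteSpace X] [IsFiniteMeasure μ]
    (hf : ∀ x, IntegrableOn (f x) (Ioc 0 1))
    (hμ : ∀ x A, MeasurableSet A → A ⊆ Ioc 0 1 → |∫ t in A, f x t| ≤ μ.real A * ‖x‖)
    (hΦ : ∀ I, Φ I ∈ cb X)
    (hΦf : ∀ x (I : Subinterval), ∫ t in Ioc I.left I.right, f x t = supp x (Φ I))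
    {U : Set ℝ} (hU : IsOpen U) :
    ∃ C ∈ cb X, ∀ x, supp x C = ∫ t in U ∩ Ioc 0 1, f x t := by
  classical
  let T : (n : ℕ) → Finset (Fin (n + 1)) := fun n =>
    Finset.univ.filter fun k => Ioc (gridInterval n k).left (gridInterval n k).right ⊆ U
  let S : ℕ → Set ℝ := fun n =>
    ⋃ k ∈ T n, Ioc (gridInterval n k).left (gridInterval n k).right
  have hSU : ∀ n, S n ⊆ U ∩ Ioc 0 1 := fun n => iUnion₂_subset fun k hk =>
    subset_inter (Finset.mem_filter.1 hk).2
      (Ioc_subset_Ioc (gridInterval n k).zero_le_left (gridInterval n k).right_le_one)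
  have hSm : ∀ n, MeasurableSet (S n) := fun n =>
    (T n).measurableSet_biUnion fun _ _ => measurableSet_Ioc
  have hUm : MeasurableSet (U ∩ Ioc 0 1) := hU.measurableSet.inter measurableSet_Ioc
  refine exists_mem_cb_of_tendsto_measure hf hμ hUm inter_subset_right hSm
    (fun n => (hSU n).trans inter_subset_right) ?_ ?_ fun n =>
      exists_mem_cb_biUnion hf hΦ hΦf (T n) (gridInterval n)
        fun j _ k _ hjk => gridInterval_pairwise_disjoint n hjk
  · have : ∀ n, S n \ (U ∩ Ioc 0 1) = ∅ := fun n => sdiff_eq_empty.2 (hSU n)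
    simp [this]
  · have := tendsto_measure_of_tendsto_indicator_of_isFiniteMeasure (A := ∅) atTop μ
      (As := fun n => (U ∩ Ioc 0 1) \ S n) (fun n => hUm.diff (hSm n)) fun t => ?_
    · simpa using this
    · by_cases ht : t ∈ U ∩ Ioc 0 1
      · obtain ⟨r, hr, hrU⟩ := Metric.isOpen_iff.1 hU t ht.1
        filter_upwards [tendsto_one_div_add_atTop_nhds_zero_nat.eventually (gt_mem_nhds hr)]
          with n hn
        obtain ⟨k, hk⟩ := exists_mem_gridInterval n ht.2
        have hlen : (gridInterval n k).right - (gridInterval n k).left < r := by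
          refine lt_of_eq_of_lt ?_ hn
          simp only [gridInterval]
          ring
        have htS : t ∈ S n := by
          refine mem_biUnion (Finset.mem_filter.2 ⟨Finset.mem_univ k, fun u hu => hrU ?_⟩) hk
          rw [Metric.mem_ball, Real.dist_eq, abs_lt]
          constructor <;> linarith [hu.1, hu.2, hk.1, hk.2]
        simp [htS]
      · exact Eventually.of_forall fun n => iff_of_false (fun h => ht h.1) (notMem_empty _)

theorem exists_mem_cb_measurableSet [CompleteSpace X] [IsFiniteMeasure μ]
    (hf : ∀ x, IntegrableOn (f x) (Ioc 0 1))
    (hμ : ∀ x A, MeasurableSet A → A ⊆ Ioc 0 1 → |∫ t in A, f x t| ≤ μ.real A * ‖x‖)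
    (hΦ : ∀ I, Φ I ∈ cb X)
    (hΦf : ∀ x (I : Subinterval), ∫ t in Ioc I.left I.right, f x t = supp x (Φ I))
    {A : Set ℝ} (hA : MeasurableSet A) (hA1 : A ⊆ Ioc 0 1) :
    ∃ C ∈ cb X, ∀ x, supp x C = ∫ t in A, f x t := by
  -- Outer regularity of `μ` reduces measurable sets to open ones.
  have hex : ∀ n : ℕ, ∃ U, U ⊇ A ∧ IsOpen U ∧ μ U < ⊤ ∧ μ (U \ A) < ((n : ENNReal) + 1)⁻¹ :=
    fun n => hA.exists_isOpen_sdiff_lt (measure_ne_top μ A) (by simp)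
  choose U hAU hUo _ hU using hex
  refine exists_mem_cb_of_tendsto_measure hf hμ hA hA1
    (fun n => (hUo n).measurableSet.inter measurableSet_Ioc) (fun n => inter_subset_right)
    ?_ ?_ fun n => exists_mem_cb_isOpen_inter hf hμ hΦ hΦf (hUo n)
  · have hlim : Tendsto (fun n : ℕ => ((n : ENNReal) + 1)⁻¹) atTop (𝓝 0) := by
      have := (tendsto_add_atTop_iff_nat 1).2 ENNReal.tendsto_inv_nat_nhds_zero
      simpa using this
    exact tendsto_of_tendsto_of_tendsto_of_le_of_le tendsto_const_nhds hlim (fun _ => bot_le)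
      fun n => (measure_mono (sdiff_subset_sdiff_left inter_subset_left)).trans (hU n).le
  · have : ∀ n, A \ (U n ∩ Ioc 0 1) = ∅ := fun n => sdiff_eq_empty.2 (subset_inter (hAU n) hA1)
    simp [this]

/-- The support functions of the partial sum and of the value on the union differ by an integral
over the tail, so the Hausdorff distance is at most the `μ`-measure of the tail. -/
theorem tendsto_hausdorffDist_sum_of_supp_eq [IsFiniteMeasure μ]
    (hf : ∀ x, IntegrableOn (f x) (Ioc 0 1))
    (hμ : ∀ x A, MeasurableSet A → A ⊆ Ioc 0 1 → |∫ t in A, f x t| ≤ μ.real A * ‖x‖)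
    {M : Set ℝ → Set X}
    (hM : ∀ A ∈ lebesgueSets, M A ∈ cb X ∧ ∀ x, supp x (M A) = ∫ t in A, f x t) :
    IsHMultimeasure M := by
  intro A hA hdisj
  choose B hBA hB1 hBm hBae using fun n => exists_measurable_subset_ae_eq_of_mem_lebesgueSets (hA n)
  have hBdisj : Pairwise (Function.onFun Disjoint B) := fun i j hij =>
    (hdisj hij).mono (hBA i) (hBA j)
  have hUA : (⋃ i, A i) ∈ lebesgueSets :=
    ⟨iUnion_subset fun i => (hA i).1, NullMeasurableSet.iUnion fun i => (hA i).2⟩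
  have hUB1 : (⋃ i, B i) ⊆ Ioc 0 1 := iUnion_subset hB1
  have hUBm : MeasurableSet (⋃ i, B i) := MeasurableSet.iUnion hBm
  have hUae : (⋃ i, B i) =ᵐ[volume] (⋃ i, A i) := Filter.EventuallyEq.countable_iUnion hBae
  let P : ℕ → Set ℝ := fun n => ⋃ i ∈ Finset.range n, B i
  have hPm : ∀ n, MeasurableSet (P n) := fun n =>
    (Finset.range n).measurableSet_biUnion fun i _ => hBm i
  have hPsub : ∀ n, P n ⊆ ⋃ i, B i := fun n => iUnion₂_subset fun i _ => subset_iUnion B i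
  have hlim : Tendsto (fun n => μ.real ((⋃ i, B i) \ P n)) atTop (𝓝 0) := by
    have := tendsto_measure_of_tendsto_indicator_of_isFiniteMeasure (A := ∅) atTop μ
      (As := fun n => (⋃ i, B i) \ P n) (fun n => hUBm.diff (hPm n)) fun t => ?_
    · rw [measure_empty] at this
      exact (ENNReal.tendsto_toReal ENNReal.zero_ne_top).comp this
    · by_cases ht : t ∈ ⋃ i, B i
      · obtain ⟨i, hi⟩ := mem_iUnion.1 ht
        filter_upwards [eventually_gt_atTop i] with n hn
        refine iff_of_false (fun h => h.2 ?_) (notMem_empty _)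
        exact mem_biUnion (Finset.mem_coe.2 (Finset.mem_range.2 hn)) hi
      · exact Eventually.of_forall fun n => iff_of_false (fun h => ht h.1) (notMem_empty _)
  refine squeeze_zero (fun _ => Metric.hausdorffDist_nonneg) (fun n => ?_) hlim
  refine hausdorffDist_le_of_abs_supp_sub_le
    (closure_sum_mem_cb _ fun i _ => (hM _ (hA i)).1) (hM _ hUA).1 measureReal_nonneg fun x => ?_
  have i1 : supp x (closure (∑ i ∈ Finset.range n, M (A i))) = ∫ t in P n, f x t := by
    rw [supp_closure_sum _ fun i _ => (hM _ (hA i)).1, integral_biUnion_finset _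
      (fun i _ => hBm i) (fun i _ j _ hij => hBdisj hij) fun i _ => (hf x).mono_set (hB1 i)]
    refine Finset.sum_congr rfl fun i _ => ?_
    rw [(hM _ (hA i)).2, setIntegral_congr_set (hBae i)]
  have i2 : supp x (M (⋃ i, A i)) =
      (∫ t in P n, f x t) + ∫ t in (⋃ i, B i) \ P n, f x t := by
    rw [(hM _ hUA).2, ← setIntegral_congr_set hUae,
      ← integral_inter_add_sdiff (hPm n) ((hf x).mono_set hUB1), inter_eq_right.2 (hPsub n)]
  rw [i1, i2, sub_add_cancel_left, abs_neg]
  exact hμ x _ (hUBm.diff (hPm n)) (sdiff_subset.trans hUB1)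

end Pettis

theorem IsDKPIntegral.stronglyPettisIntegrable [CompleteSpace X] (hΦ : IsDKPIntegral Γ Φ)
    (hvar : intervalVariation (fun I => Metric.hausdorffDist (Φ I) {0}) < ⊤) :
    StronglyPettisIntegrable Γ := by
  obtain ⟨v, hv, -⟩ := exists_abs_le_sub_of_intervalVariation_lt_top hvar
  have hvx : ∀ x : StrongDual ℝ X, ‖x‖ ≤ 1 →
      ∀ I : Subinterval, |supp x (Φ I)| ≤ v I.right - v I.left := by
    intro x hx I
    refine (abs_supp_le_hausdorffDist_zero x (hΦ.1 I).1 (hΦ.1 I).2.2.2).trans ?_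
    refine le_trans ?_ ((le_abs_self _).trans (hv I))
    exact mul_le_of_le_one_left Metric.hausdorffDist_nonneg hx
  have hball := fun (x : StrongDual ℝ X) (hx : ‖x‖ ≤ 1) =>
    hΦ.integrableOn_and_supp_eq (hvx x hx)
  have hall := integrableOn_and_supp_eq_of_closedBall hball
  have hscalar : ScalarlyIntegrable Γ := fun x => (hall x).1
  obtain ⟨μ, _, -, hμ⟩ := exists_measure_abs_setIntegral_supp_le (Γ := Γ) (Φ := Φ)
    fun I => (abs_nonneg _).trans (hv I)
  have hμ' : ∀ (x : StrongDual ℝ X) A, MeasurableSet A → A ⊆ Ioc 0 1 →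
      |∫ t in A, supp x (Γ t)| ≤ μ.real A * ‖x‖ := fun x A hA hA1 =>
    abs_le_mul_norm_of_smul (setIntegral_supp_smul Γ A)
      (fun x hx => hμ x (hall x).1 (hall x).2 (hvx x hx) A hA hA1) x
  have hf : ∀ x : StrongDual ℝ X, IntegrableOn (fun t => supp x (Γ t)) (Ioc 0 1) :=
    fun x => (hscalar x).mono_set Ioc_subset_Icc_self
  have hex : ∀ A : Set ℝ, ∃ C : Set X, A ∈ lebesgueSets →
      C ∈ cb X ∧ ∀ x, supp x C = ∫ t in A, supp x (Γ t) := by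
    intro A
    by_cases hA : A ∈ lebesgueSets
    · obtain ⟨B, -, hB1, hBm, hBA⟩ := exists_measurable_subset_ae_eq_of_mem_lebesgueSets hA
      obtain ⟨C, hC, hCs⟩ := exists_mem_cb_measurableSet hf hμ' hΦ.1 (fun x => (hall x).2) hBm hB1
      exact ⟨C, fun _ => ⟨hC, fun x => by rw [hCs, setIntegral_congr_set hBA]⟩⟩
    -- An arbitrary value off the Lebesgue sets lets `choose` produce a total function `M`.
    · exact ⟨∅, fun h => absurd h hA⟩
  choose M hM using hex
  exact ⟨M, ⟨hscalar, hM⟩, tendsto_hausdorffDist_sum_of_supp_eq hf hμ' hM⟩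

end Integrals

end MultiIntegral

end

theorem mainTheorem1 {X : Type*} [NormedAddCommGroup X] [NormedSpace ℝ X] [CompleteSpace X]
    (Γ : ℝ → Set X) (hΓ : ∀ t ∈ Set.Icc (0 : ℝ) 1, Γ t ∈ MultiIntegral.cb X)
    (Φ : MultiIntegral.Subinterval → Set X) (hΦ : MultiIntegral.IsDKPIntegral Γ Φ) :
    ((⨆ x ∈ Metric.closedBall (0 : StrongDual ℝ X) 1,
        MultiIntegral.intervalVariation (fun I => MultiIntegral.supp x (Φ I))) < ⊤ →
      MultiIntegral.WeaklyMcShaneIntegrable Γ ∧ MultiIntegral.GelfandIntegrable Γ) ∧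
    (MultiIntegral.intervalVariation (fun I => Metric.hausdorffDist (Φ I) {0}) < ⊤ →
      MultiIntegral.StronglyPettisIntegrable Γ) := by
  exact ⟨hΦ.weaklyMcShaneIntegrable_and_gelfandIntegrable hΓ, hΦ.stronglyPettisIntegrable⟩
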